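/- **Setting.** Let $m,q\ge 0$ and $p\ge 1$ be integers; all spaces $\mathbb{R}^d$ and their products carry Euclidean inner products and norms. Let $F:\mathbb{R}^p\to\mathbb{R}\cup\{+\infty\}$ and $G:\mathbb{R}^q\to\mathbb{R}\cup\{+\infty\}$ be proper and lower semicontinuous, $H:\mathbb{R}^m\times\mathbb{R}^q\to\mathbb{R}$ continuously differentiable, and $A:\mathbb{R}^m\to\mathbb{R}^p$ linear; consider $\min_{(x,y)}\{F(Ax)+G(y)+H(x,y)\}$. For $\mu,\beta,\tau>0$ and $0<\sigma\le 1$ let $\{(x_n,y_n,z_n,u_n)\}_{n\ge0}\subset\mathbb{R}^m\times\mathbb{R}^q\times\mathbb{R}^p\times\mathbb{R}^p$ be a sequence with arbitrary starting point such that for all $n\ge 0$ $$y_{n+1}\in\arg\min_{y}\Big\{G(y)+\langle\nabla_yH(x_n,y_n),y\rangle+\tfrac{\mu}{2}\|y-y_n\|^2\Big\},$$ $$z_{n+1}\in\arg\min_{z}\Big\{F(z)+\langle u_n,Ax_n-z\rangle+\tfrac{\beta}{2}\|Ax_n-z\|^2\Big\},$$ $$x_{n+1}=x_n-\tau^{-1}\big(\nabla_xH(x_n,y_{n+1})+A^Tu_n+\beta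 A^T(Ax_n-z_{n+1})\big),\qquad u_{n+1}=u_n+\sigma\beta(Ax_{n+1}-z_{n+1}).$$ Assume that 1. $F,G,H$ are bounded from below, and $A$ is surjective; 2. the sequence $\{(x_n,y_n,z_n,u_n)\}_{n\ge0}$ is bounded; 3. there are $L>0$ and convex bounded sets $B_1\subseteq\mathbb{R}^m$, $B_2\subseteq\mathbb{R}^q$ with $(x_n,y_n)\in B_1\times B_2$ for all $n\ge0$ such that $\nabla H$ is $L$-Lipschitz on $B_1\times B_2$; 4. with $\lambda:=\lambda_{\min}(AA^T)$, one has $2\tau\ge\beta\|A\|^2$ and $\min\{C_2,C_3,C_4\}>0$, where $$C_2=\tau-\frac{L\sqrt2+\beta\|A\|^2}{2}-\frac{4\sigma\tau^2}{\beta\lambda}-\frac{8(\sigma\tau+L\sqrt2)^2}{\sigma\beta\lambda},\qquad C_3=\frac{\mu-L\sqrt2}{2}-\frac{16L^2}{\sigma\beta\lambda},\qquad C_4=\frac1{\sigma\beta}.$$ Define $\Psi$ on $\mathbf{R}:=\mathbb{R}^m\times\mathbb{R}^q\times\mathbb{R}^p\times\mathbb{R}^p\times\mathbb{R}^m\times\mathbb{R}^p$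 by $$\Psi(x,y,z,u,x',u')=F(z)+G(y)+H(x,y)+\langle u,Ax-z\rangle+\tfrac{\beta}{2}\|Ax-z\|^2+C_0\|A^T(u-u')+\sigma B(x-x')\|^2+C_1\|x-x'\|^2,$$ where $B=\tau\,\mathrm{Id}-\beta A^TA$, $C_0=\frac{4(1-\sigma)}{\sigma^2\beta\lambda}$, $C_1=\frac{8(\sigma\tau+L\sqrt2)^2}{\sigma\beta\lambda}$. Let $\partial$ denote the limiting (Mordukhovich) subdifferential (empty outside the effective domain). A point $\hat v$ is critical for $\Psi$ if $0\in\partial\Psi(\hat v)$. We say that $\Psi$ satisfies the Łojasiewicz inequality at $\hat v$ with constant $C_L>0$ and exponent $\theta\in[0,1)$ if for some $\varepsilon>0$ $$|\Psi(v)-\Psi(\hat v)|^\theta\le C_L\,\mathrm{dist}(0,\partial\Psi(v))\qquad\text{for all } v \text{ with } \|v-\hat v\|<\varepsilon,$$ with the conventions $0^0=0$ and $\mathrm{dist}(0,\emptyset)=+\infty$. Assume finally that $\Psi$ has the Łojasiewicz property: at every critical point it satisfies the Łojasiewicz inequality with some constant and some exponent, which may depend on the point. **Theorem.** The sequence $\{(x_n,y_n,z_n,u_n)\}$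 converges to a KKT point $(x_*,y_*,z_*,u_*)$ of the problem, i.e. $-A^Tu_*=\nabla_xH(x_*,y_*)$, $0\in\partial G(y_*)+\nabla_yH(x_*,y_*)$, $u_*\in\partial F(z_*)$, $z_*=Ax_*$, and $\mathbf{X}_*:=(x_*,y_*,z_*,u_*,x_*,u_*)$ is a critical point of $\Psi$. If $\Psi$ satisfies the Łojasiewicz inequality at $\mathbf{X}_*$ with constant $C_L>0$ and exponent $\theta\in[0,1)$, then: (i) if $\theta=0$, there is $n_0$ such that $(x_n,y_n,z_n,u_n)=(x_*,y_*,z_*,u_*)$ for all $n\ge n_0$; (ii) if $\theta\in(0,1/2]$, there are $n_0\ge1$, $K_1,K_2,K_3,K_4>0$ and $Q\in[0,1)$ such that for all $n\ge n_0$ $$\|x_n-x_*\|\le K_1Q^n,\quad\|y_n-y_*\|\le K_2Q^n,\quad\|z_n-z_*\|\le K_3Q^n,\quad\|u_n-u_*\|\le K_4Q^n;$$ (iii) if $\theta\in(1/2,1)$, there are $n_0\ge1$ and $K_1,K_2,K_3,K_4>0$ such that for all $n\ge n_0+1$ each of $\|x_n-x_*\|$, $\|y_n-y_*\|$, $\|z_n-z_*\|$,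 $\|u_n-u_*\|$ is at most $K_i\,n^{-\frac{1-\theta}{2\theta-1}}$ (with $i=1,2,3,4$ respectively). -/

import Mathlib

open Filter Topology

noncomputable section

namespace SplittingKL

/-- The Euclidean space `ℝ^d`. -/
abbrev E (d : ℕ) : Type := EuclideanSpace ℝ (Fin d)

section Subdifferential

variable {V : Type*} [NormedAddCommGroup V] [InnerProductSpace ℝ V]

/-- A function with values in `ℝ ∪ {+∞}` which is not identically `+∞`. -/
def Proper (ψ : V → EReal) : Prop :=
  (∀ v, ψ v ≠ ⊥) ∧ ∃ v, ψ v ≠ ⊤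

/-- The function is bounded from below by a real number. -/
def IsBoundedBelow (ψ : V → EReal) : Prop :=
  ∃ c : ℝ, ∀ v, (c : EReal) ≤ ψ v

/-- The set of global minimizers. -/
def argmin (ψ : V → EReal) : Set V :=
  {a | ∀ b, ψ a ≤ ψ b}

/-- The Fréchet subdifferential; it is empty outside the effective domain. -/
def frechetSubdiff (ψ : V → EReal) (v : V) : Set V :=
  {d | ψ v < ⊤ ∧
    0 ≤ liminf (fun w => (ψ w - ψ v - ((inner ℝ d (w - v) : ℝ) : EReal)) / ((‖w - v‖ : ℝ) : EReal))
      (𝓝[≠] v)}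

/-- The limiting (Mordukhovich) subdifferential; it is empty outside the effective domain. -/
def limitingSubdiff (ψ : V → EReal) (v : V) : Set V :=
  {d | ψ v < ⊤ ∧ ∃ (vs ds : ℕ → V),
    Tendsto vs atTop (𝓝 v) ∧ Tendsto ds atTop (𝓝 d) ∧
    Tendsto (fun n => ψ (vs n)) atTop (𝓝 (ψ v)) ∧
    ∀ n, ds n ∈ frechetSubdiff ψ (vs n)}

/-- The set of critical points. -/
def crit (ψ : V → EReal) : Set V :=
  {v | (0 : V) ∈ limitingSubdiff ψ v}

/-- The Łojasiewicz inequality `|ψ v - ψ v₀| ^ θ ≤ C * dist (0, ∂ψ v)` on some open ball around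
`v₀`, where `dist (0, ∅) = +∞`. The restriction to `ψ v ≠ ψ v₀` is the convention `0 ^ 0 = 0`
(for `0 < θ` the inequality is trivial at points where `ψ v = ψ v₀`). -/
def LojasiewiczAt (ψ : V → EReal) (v₀ : V) (C θ : ℝ) : Prop :=
  ∃ ε > 0, ∀ v ∈ Metric.ball v₀ ε, ψ v ≠ ψ v₀ →
    (ψ v - ψ v₀).abs ^ θ ≤ ENNReal.ofReal C * Metric.infEDist 0 (limitingSubdiff ψ v)

/-- The Łojasiewicz property: around every critical point the Łojasiewicz inequality holds
with some constant and some exponent, both of which may depend on the critical point. -/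
def LojasiewiczProperty (ψ : V → EReal) : Prop :=
  ∀ v₀ ∈ crit ψ, ∃ C θ : ℝ, 0 < C ∧ 0 ≤ θ ∧ θ < 1 ∧ LojasiewiczAt ψ v₀ C θ

/-- The smallest eigenvalue of an endomorphism (used for symmetric ones on a nonzero space). -/
def lambdaMin (T : V →L[ℝ] V) : ℝ :=
  sInf {l : ℝ | Module.End.HasEigenvalue (T : V →ₗ[ℝ] V) l}

end Subdifferential

/-- The data of the problem `min F (A x) + G y + H (x, y)` over `(x, y) ∈ ℝ^m × ℝ^q`. -/
structure Problem (m q p : ℕ) where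
  F : E p → EReal
  G : E q → EReal
  H : E m → E q → ℝ
  A : E m →L[ℝ] E p

/-- The parameters of the algorithm, and the Lipschitz modulus `L` of `∇H`. -/
structure Params where
  μ : ℝ
  β : ℝ
  τ : ℝ
  σ : ℝ
  L : ℝ

variable {m q p : ℕ}

namespace Problem

/-- The adjoint `Aᵀ`. -/
def At (P : Problem m q p) : E p →L[ℝ] E m :=
  ContinuousLinearMap.adjoint P.A

/-- The partial gradient `∇ₓ H (x, y)`. -/
def gradX (P : Problem m q p) (x : E m) (y : E q) : E m :=
  gradient (fun x' => P.H x' y) x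

/-- The partial gradient `∇_y H (x, y)`. -/
def gradY (P : Problem m q p) (x : E m) (y : E q) : E q :=
  gradient (fun y' => P.H x y') y

/-- `λ_min (A Aᵀ)`. -/
def lam (P : Problem m q p) : ℝ :=
  lambdaMin (P.A.comp P.At)

/-- `F` and `G` are proper and lower semicontinuous, `H` is continuously differentiable. -/
structure WellPosed (P : Problem m q p) : Prop where
  proper_F : Proper P.F
  proper_G : Proper P.G
  lsc_F : LowerSemicontinuous P.F
  lsc_G : LowerSemicontinuous P.G
  smooth_H : ContDiff ℝ 1 (fun w : E m × E q => P.H w.1 w.2)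

/-- KKT points of the problem. -/
def IsKKT (P : Problem m q p) (x : E m) (y : E q) (z : E p) (u : E p) : Prop :=
  -(P.At u) = P.gradX x y ∧
  (∃ g ∈ limitingSubdiff P.G y, g + P.gradY x y = 0) ∧
  u ∈ limitingSubdiff P.F z ∧
  z = P.A x

/-- `(x, y, z, u)` is a sequence generated by the algorithm (from an arbitrary starting point). -/
def IsGenerated (P : Problem m q p) (c : Params)
    (x : ℕ → E m) (y : ℕ → E q) (z : ℕ → E p) (u : ℕ → E p) : Prop :=
  ∀ n : ℕ,
    y (n + 1) ∈ argmin (fun v : E q =>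
      P.G v + ((inner ℝ (P.gradY (x n) (y n)) v + c.μ / 2 * ‖v - y n‖ ^ 2 : ℝ) : EReal)) ∧
    z (n + 1) ∈ argmin (fun w : E p =>
      P.F w + ((inner ℝ (u n) (P.A (x n) - w) + c.β / 2 * ‖P.A (x n) - w‖ ^ 2 : ℝ) : EReal)) ∧
    x (n + 1) = x n - c.τ⁻¹ • (P.gradX (x n) (y (n + 1)) + P.At (u n)
      + c.β • P.At (P.A (x n) - z (n + 1))) ∧
    u (n + 1) = u n + (c.σ * c.β) • (P.A (x (n + 1)) - z (n + 1))

/-- `B = τ Id - β Aᵀ A`. -/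
def B (P : Problem m q p) (c : Params) : E m →L[ℝ] E m :=
  c.τ • ContinuousLinearMap.id ℝ (E m) - c.β • P.At.comp P.A

def C₀ (P : Problem m q p) (c : Params) : ℝ :=
  4 * (1 - c.σ) / (c.σ ^ 2 * c.β * P.lam)

def C₁ (P : Problem m q p) (c : Params) : ℝ :=
  8 * (c.σ * c.τ + c.L * √2) ^ 2 / (c.σ * c.β * P.lam)

def C₂ (P : Problem m q p) (c : Params) : ℝ :=
  c.τ - (c.L * √2 + c.β * ‖P.A‖ ^ 2) / 2 - 4 * c.σ * c.τ ^ 2 / (c.β * P.lam)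
    - 8 * (c.σ * c.τ + c.L * √2) ^ 2 / (c.σ * c.β * P.lam)

def C₃ (P : Problem m q p) (c : Params) : ℝ :=
  (c.μ - c.L * √2) / 2 - 16 * c.L ^ 2 / (c.σ * c.β * P.lam)

def C₄ (c : Params) : ℝ :=
  1 / (c.σ * c.β)

end Problem

/-- The product space `ℝ^m × ℝ^q × ℝ^p × ℝ^p × ℝ^m × ℝ^p` with its Euclidean norm. -/
abbrev R (m q p : ℕ) : Type :=
  WithLp 2 (E m × WithLp 2 (E q × WithLp 2 (E p × WithLp 2 (E p × WithLp 2 (E m × E p)))))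

/-- The point `(x, y, z, u, x', u')` of the product space. -/
def mkR (x : E m) (y : E q) (z : E p) (u : E p) (x' : E m) (u' : E p) : R m q p :=
  WithLp.toLp 2 (x, WithLp.toLp 2 (y, WithLp.toLp 2 (z, WithLp.toLp 2 (u, WithLp.toLp 2 (x', u')))))

/-- The regularized augmented Lagrangian as a function of its six arguments. -/
def Problem.PsiFun (P : Problem m q p) (c : Params)
    (x : E m) (y : E q) (z : E p) (u : E p) (x' : E m) (u' : E p) : EReal :=
  P.F z + P.G y +
    ((P.H x y + inner ℝ u (P.A x - z) + c.β / 2 * ‖P.A x - z‖ ^ 2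
      + P.C₀ c * ‖P.At (u - u') + c.σ • P.B c (x - x')‖ ^ 2
      + P.C₁ c * ‖x - x'‖ ^ 2 : ℝ) : EReal)

/-- The regularized augmented Lagrangian on the Euclidean product space. -/
def Problem.Psi (P : Problem m q p) (c : Params) (X : R m q p) : EReal :=
  P.PsiFun c X.fst X.snd.fst X.snd.snd.fst X.snd.snd.snd.fst
    X.snd.snd.snd.snd.fst X.snd.snd.snd.snd.snd

/-- The assumptions on the problem, the parameters and the generated sequence. -/
structure Problem.Assumptions (P : Problem m q p) (c : Params)
    (x : ℕ → E m) (y : ℕ → E q) (z : ℕ → E p) (u : ℕ → E p) : Prop where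
  bddBelow_F : IsBoundedBelow P.F
  bddBelow_G : IsBoundedBelow P.G
  bddBelow_H : ∃ b : ℝ, ∀ x' y', b ≤ P.H x' y'
  surjective_A : Function.Surjective P.A
  bounded_seq : ∃ M : ℝ, ∀ n, ‖x n‖ ≤ M ∧ ‖y n‖ ≤ M ∧ ‖z n‖ ≤ M ∧ ‖u n‖ ≤ M
  L_pos : 0 < c.L
  lipschitz_grad : ∃ (B₁ : Set (E m)) (B₂ : Set (E q)),
    Convex ℝ B₁ ∧ Convex ℝ B₂ ∧ Bornology.IsBounded B₁ ∧ Bornology.IsBounded B₂ ∧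
    (∀ n, x n ∈ B₁ ∧ y n ∈ B₂) ∧
    ∀ a ∈ B₁, ∀ a' ∈ B₁, ∀ b ∈ B₂, ∀ b' ∈ B₂,
      √(‖P.gradX a b - P.gradX a' b'‖ ^ 2 + ‖P.gradY a b - P.gradY a' b'‖ ^ 2)
        ≤ c.L * √(‖a - a'‖ ^ 2 + ‖b - b'‖ ^ 2)
  μ_pos : 0 < c.μ
  β_pos : 0 < c.β
  τ_pos : 0 < c.τ
  σ_pos : 0 < c.σ
  σ_le_one : c.σ ≤ 1
  two_τ : c.β * ‖P.A‖ ^ 2 ≤ 2 * c.τ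
  C_pos : 0 < min (P.C₂ c) (min (P.C₃ c) (Problem.C₄ c))

end SplittingKL

end

noncomputable section

namespace SplittingKL

open Asymptotics

variable {m q p : ℕ}

/-! ### Real sequences governed by sufficient decrease and a Łojasiewicz inequality -/

section RealSequences

/-! `Ψ`, evaluated at `X_n = (x_{n+1}, y_{n+1}, z_{n+1}, u_{n+1}, x_n, u_n)`, is a Lyapunov function
for the algorithm, and the theorem is a Kurdyka–Łojasiewicz argument built on three facts about it.

Decrease (`psi_descent`). The two minimizations and the gradient step lower the augmented
Lagrangian; only the dual update raises it, by exactly `‖Δu‖² / (σβ)`. Since `A` is surjective,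
`λ‖Δu‖² ≤ ‖AᵀΔu‖²`. The combination `w = AᵀΔu + σBΔx` no longer contains `z` and satisfies `w⁺ = (1
- σ) w + σ v` with `v = O(‖Δx‖ + ‖Δy⁺‖)` (`aux_contraction`). So `‖Δu‖²` is paid for by a
telescoping difference of `‖w‖²`, which is the `C₀` term of `Ψ`, by the previous `‖Δx‖²`, which is
the `C₁` term, and by part of the decrease in `x` and `y`.

Small subgradients (`subgradPsi_mem`, `isBigO_subgradPsi`). The optimality conditions of the two
subproblems give an element of `∂Ψ(X_n)` of norm `O(s_n)`, where `s_n` is the length of the step in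
`(x, y, u)`.

Limits of values (`tendsto_toReal_of_mem_argmin`). `F` and `G` are only lower semicontinuous, but
along minimizers their values do converge. Hence each cluster point is a KKT point and a critical
point, and `Ψ` takes there the limit `l` of the values `Ψ(X_n)` (`cluster_point`).

Put `e_n = Ψ(X_n) - l`. Near a cluster point, decrease and the inequality `e_n^θ ≤ C s_n` combine,
by concavity of `t ↦ t^(1-θ)`, to `2 s_{n+1} + K e_{n+1}^(1-θ) ≤ s_n + K e_n^(1-θ)`. This traps the
sequence, forces convergence, and bounds the distance to the limit by `s_n + K e_n^(1-θ)`
(`loja_trap`). The variable `z` follows because `Ax - z` is a multiple of `Δu`. Eliminating `s`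
instead gives `e_{n+1} + b e_{n+1}^(2θ) ≤ e_n`, whose solutions vanish eventually for `θ = 0`, decay
geometrically for `θ ≤ 1/2`, and decay like `n^(-1/(2θ-1))` for `θ > 1/2`. -/

theorem mul_sub_le_rpow_sub_rpow {a b θ : ℝ} (ha : 0 < a) (hb : 0 ≤ b) (h0 : 0 ≤ θ) (h1 : θ < 1) :
    (1 - θ) * (a - b) ≤ a ^ θ * (a ^ (1 - θ) - b ^ (1 - θ)) := by
  have hba : 0 ≤ b / a := by positivity
  -- Bernoulli's inequality for the exponent `1 - θ ≤ 1`: the concave power lies below its tangent,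
  -- here at `b / a = 1`.
  have h := rpow_one_add_le_one_add_mul_self (s := b / a - 1) (by linarith) (p := 1 - θ)
    (by linarith) (by linarith)
  rw [add_sub_cancel, Real.div_rpow hb ha.le] at h
  have hpos : 0 < a ^ (1 - θ) := Real.rpow_pos_of_pos ha _
  rw [div_le_iff₀ hpos] at h
  have hm : a ^ θ * a ^ (1 - θ) = a := by
    rw [← Real.rpow_add ha]; simp
  have hθ : 0 ≤ a ^ θ := (Real.rpow_pos_of_pos ha _).le
  have h2 := mul_le_mul_of_nonneg_left h hθ
  have h3 : a ^ θ * ((1 + (1 - θ) * (b / a - 1)) * a ^ (1 - θ))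
      = a + (1 - θ) * (b - a) := by
    calc a ^ θ * ((1 + (1 - θ) * (b / a - 1)) * a ^ (1 - θ))
        = (a ^ θ * a ^ (1 - θ)) * (1 + (1 - θ) * (b / a - 1)) := by ring
      _ = a + (1 - θ) * (b - a) := by rw [hm]; field_simp
  rw [h3] at h2
  rw [mul_sub (a ^ θ), hm]
  linarith

/-- One step of the finite length argument. -/
theorem two_mul_le_of_loja {a C θ e₀ e₁ s₀ s₁ : ℝ} (ha : 0 < a) (hC : 0 < C)
    (h0 : 0 ≤ θ) (h1 : θ < 1) (he₀ : 0 ≤ e₀) (he₁ : 0 ≤ e₁) (hs₀ : 0 ≤ s₀) (hs₁ : 0 ≤ s₁)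
    (hdesc : e₁ + a * s₁ ^ 2 ≤ e₀) (hL : e₀ ≠ 0 → e₀ ^ θ ≤ C * s₀) :
    2 * s₁ + C / (a * (1 - θ)) * e₁ ^ (1 - θ) ≤ s₀ + C / (a * (1 - θ)) * e₀ ^ (1 - θ) := by
  have h1' : 0 < 1 - θ := by linarith
  rcases he₀.eq_or_lt with h | h
  · subst h
    have h2 : 0 ≤ a * s₁ ^ 2 := by positivity
    have h3 : e₁ = 0 := by linarith
    have h4 : s₁ = 0 := by
      have : a * s₁ ^ 2 = 0 := by linarith
      simpa [ha.ne'] using this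
    subst h3 h4
    linarith
  · have hmain := mul_sub_le_rpow_sub_rpow h he₁ h0 h1
    have hmono : e₁ ^ (1 - θ) ≤ e₀ ^ (1 - θ) :=
      Real.rpow_le_rpow he₁ (by nlinarith [sq_nonneg s₁]) h1'.le
    set Δ := e₀ ^ (1 - θ) - e₁ ^ (1 - θ) with hΔ
    have hΔ0 : 0 ≤ Δ := by linarith
    have h5 : (1 - θ) * (a * s₁ ^ 2) ≤ C * s₀ * Δ :=
      calc (1 - θ) * (a * s₁ ^ 2) ≤ (1 - θ) * (e₀ - e₁) := by gcongr; linarith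
        _ ≤ e₀ ^ θ * Δ := hmain
        _ ≤ C * s₀ * Δ := by gcongr; exact hL h.ne'
    -- `s₁` is at most the geometric mean of `s₀` and `KΔ`, so the arithmetic mean bounds it and the
    -- gap term telescopes.
    have h6 : s₁ ^ 2 ≤ s₀ * (C / (a * (1 - θ)) * Δ) := by
      have : s₀ * (C / (a * (1 - θ)) * Δ) = (C * s₀ * Δ) / (a * (1 - θ)) := by ring
      rw [this, le_div_iff₀ (by positivity)]
      linarith
    have h7 : 0 ≤ C / (a * (1 - θ)) * Δ := by positivity
    have h8 : 2 * s₁ ≤ s₀ + C / (a * (1 - θ)) * Δ := by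
      apply le_of_sq_le_sq _ (by positivity)
      nlinarith [sq_nonneg (s₀ - C / (a * (1 - θ)) * Δ)]
    have h9 : C / (a * (1 - θ)) * Δ
        = C / (a * (1 - θ)) * e₀ ^ (1 - θ) - C / (a * (1 - θ)) * e₁ ^ (1 - θ) := by
      rw [hΔ]; ring
    linarith

variable {a C θ ε : ℝ} {e s d : ℕ → ℝ}

theorem tendsto_zero_of_sq_descent (ha : 0 < a) (hs : ∀ n, 0 ≤ s n)
    (hdesc : ∀ n, e (n + 1) + a * s (n + 1) ^ 2 ≤ e n) {l : ℝ} (hlim : Tendsto e atTop (𝓝 l)) :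
    Tendsto s atTop (𝓝 0) := by
  rw [← tendsto_add_atTop_iff_nat 1]
  have h1 : Tendsto (fun n => (e n - e (n + 1)) / a) atTop (𝓝 0) := by
    have := (hlim.sub ((tendsto_add_atTop_iff_nat 1).2 hlim)).div_const a
    simpa using this
  have h2 : Tendsto (fun n => √((e n - e (n + 1)) / a)) atTop (𝓝 0) := by
    simpa using h1.sqrt
  refine squeeze_zero (fun n => hs _) (fun n => ?_) h2
  apply Real.le_sqrt_of_sq_le
  rw [le_div_iff₀ ha]
  linarith [hdesc n]

/-- The Kurdyka–Łojasiewicz trapping argument: once close enough to a cluster point, the sequence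
stays there, it converges, and its distance to the limit is controlled by the last step and by the
desingularized gap. -/
theorem loja_trap (ha : 0 < a) (hC : 0 < C) (h0 : 0 ≤ θ) (h1 : θ < 1) (hε : 0 < ε)
    (he : ∀ n, 0 ≤ e n) (hs : ∀ n, 0 ≤ s n) (hd : ∀ n, 0 ≤ d n)
    (hdesc : ∀ n, e (n + 1) + a * s (n + 1) ^ 2 ≤ e n) (hlim : Tendsto e atTop (𝓝 0))
    (hdd : ∀ n, |d (n + 1) - d n| ≤ s (n + 1))
    (hfreq : ∀ δ > 0, ∀ N, ∃ n ≥ N, d n < δ)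
    (hL : ∀ n, d n + s n < ε → e n ≠ 0 → e n ^ θ ≤ C * s n) :
    Tendsto d atTop (𝓝 0) ∧ ∃ N, ∀ n ≥ N,
      (e n ≠ 0 → e n ^ θ ≤ C * s n) ∧ d n ≤ s n + C / (a * (1 - θ)) * e n ^ (1 - θ) := by
  have h1' : 0 < 1 - θ := by linarith
  set K := C / (a * (1 - θ)) with hK
  have hK0 : 0 < K := by positivity
  have hs0 := tendsto_zero_of_sq_descent ha hs hdesc hlim
  have hφ : Tendsto (fun n => K * e n ^ (1 - θ)) atTop (𝓝 0) := by
    have := (hlim.rpow_const (p := 1 - θ) (Or.inr h1'.le)).const_mul K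
    simpa [Real.zero_rpow h1'.ne'] using this
  have hsφ : Tendsto (fun n => s n + K * e n ^ (1 - θ)) atTop (𝓝 0) := by
    simpa using hs0.add hφ
  have hφ0 : ∀ n, 0 ≤ K * e n ^ (1 - θ) := fun n =>
    mul_nonneg hK0.le (Real.rpow_nonneg (he n) _)
  -- The potential `d + s + K e^(1-θ)` does not increase while it is below `ε`, and being below `ε`
  -- is what makes the Łojasiewicz inequality available at the next step; the induction closes on
  -- itself.
  have key : ∀ δ > 0, δ ≤ ε → ∃ N, ∀ n ≥ N, d n + (s n + K * e n ^ (1 - θ)) < δ := by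
    intro δ hδ hδε
    obtain ⟨N₁, hN₁⟩ := eventually_atTop.1 (hsφ.eventually_lt_const (half_pos hδ))
    obtain ⟨N, hN, hdN⟩ := hfreq (δ / 2) (half_pos hδ) N₁
    refine ⟨N, fun n hn => ?_⟩
    induction n, hn using Nat.le_induction with
    | base => linarith [hN₁ N hN]
    | succ n hn ih =>
      have := two_mul_le_of_loja ha hC h0 h1 (he n) (he (n + 1)) (hs n) (hs (n + 1)) (hdesc n)
        (hL n (by linarith [hφ0 n]))
      have := (abs_le.1 (hdd n)).2
      linarith
  have hd0 : Tendsto d atTop (𝓝 0) := by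
    rw [Metric.tendsto_atTop]
    intro δ hδ
    obtain ⟨N, hN⟩ := key (min δ ε) (lt_min hδ hε) (min_le_right _ _)
    refine ⟨N, fun n hn => ?_⟩
    rw [Real.dist_eq, sub_zero, abs_of_nonneg (hd n)]
    linarith [hN n hn, min_le_left δ ε, hs n, hφ0 n]
  refine ⟨hd0, ?_⟩
  obtain ⟨N, hN⟩ := key ε hε le_rfl
  have hLN : ∀ n ≥ N, e n ≠ 0 → e n ^ θ ≤ C * s n := fun n hn =>
    hL n (by linarith [hN n hn, hφ0 n])
  refine ⟨N, fun n hn => ⟨hLN n hn, ?_⟩⟩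
  -- With `-d` in place of `+d` the potential is again nonincreasing. Its limit is `0`, hence it is
  -- nonnegative, which is the distance bound without summing the steps.
  have hW : ∀ m ≥ n, s m + K * e m ^ (1 - θ) - d m ≤ s n + K * e n ^ (1 - θ) - d n := by
    intro m hm
    induction m, hm using Nat.le_induction with
    | base => exact le_rfl
    | succ m hm ih =>
      have := two_mul_le_of_loja ha hC h0 h1 (he m) (he (m + 1)) (hs m) (hs (m + 1)) (hdesc m)
        (hLN m (hn.trans hm))
      have := (abs_le.1 (hdd m)).1
      linarith
  have hlimW : Tendsto (fun m => s m + K * e m ^ (1 - θ) - d m) atTop (𝓝 0) := by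
    simpa using hsφ.sub hd0
  have := le_of_tendsto hlimW (eventually_atTop.2 ⟨n, hW⟩)
  linarith

/-- Squaring the Łojasiewicz inequality and inserting it into the decrease eliminates the step
length. The recursion is implicit: the power is taken at `n + 1`. -/
theorem gap_rpow_le (ha : 0 < a) (hC : 0 < C) (he : ∀ n, 0 ≤ e n)
    (hdesc : ∀ n, e (n + 1) + a * s (n + 1) ^ 2 ≤ e n) {n : ℕ}
    (hL : e (n + 1) ≠ 0 → e (n + 1) ^ θ ≤ C * s (n + 1)) (hne : e (n + 1) ≠ 0) :
    e (n + 1) + a / C ^ 2 * e (n + 1) ^ (2 * θ) ≤ e n := by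
  have h1 : e (n + 1) ^ (2 * θ) = (e (n + 1) ^ θ) ^ 2 := by
    rw [mul_comm, Real.rpow_mul (he _)]; simp
  have h2 : (e (n + 1) ^ θ) ^ 2 ≤ (C * s (n + 1)) ^ 2 :=
    pow_le_pow_left₀ (Real.rpow_nonneg (he _) _) (hL hne) 2
  have h3 : a / C ^ 2 * e (n + 1) ^ (2 * θ) ≤ a * s (n + 1) ^ 2 :=
    calc a / C ^ 2 * e (n + 1) ^ (2 * θ) ≤ a / C ^ 2 * (C * s (n + 1)) ^ 2 := by
          rw [h1]; gcongr
      _ = a * s (n + 1) ^ 2 := by field_simp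
  linarith [hdesc n]

/-- For `θ = 0` reaching a nonzero gap costs at least the fixed amount `a / C²`, which a sequence
tending to `0` cannot keep paying. -/
theorem exists_gap_eq_zero (ha : 0 < a) (hC : 0 < C) (he : ∀ n, 0 ≤ e n)
    (hdesc : ∀ n, e (n + 1) + a * s (n + 1) ^ 2 ≤ e n) (hlim : Tendsto e atTop (𝓝 0))
    {N : ℕ} (hL : ∀ n ≥ N, e n ≠ 0 → e n ^ (0 : ℝ) ≤ C * s n) :
    ∃ N, ∀ n ≥ N, e n = 0 := by
  have hb : 0 < a / C ^ 2 := by positivity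
  obtain ⟨N₁, hN₁⟩ := eventually_atTop.1 (hlim.eventually_lt_const hb)
  refine ⟨max N N₁ + 1, fun n hn => ?_⟩
  obtain ⟨k, rfl⟩ : ∃ k, n = k + 1 := ⟨n - 1, by omega⟩
  by_contra hne
  have := gap_rpow_le ha hC he hdesc (hL (k + 1) (by omega)) hne
  simp only [mul_zero, Real.rpow_zero, mul_one] at this
  linarith [hN₁ k (by omega), he (k + 1)]

/-- On `[0, 1]` one has `t^(2θ) ≥ t` when `2θ ≤ 1`, so the implicit recursion yields `(1 + a / C²)
e_{n+1} ≤ e_n`. -/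
theorem exists_gap_geometric (ha : 0 < a) (hC : 0 < C) (h2 : θ ≤ 1 / 2)
    (he : ∀ n, 0 ≤ e n) (hdesc : ∀ n, e (n + 1) + a * s (n + 1) ^ 2 ≤ e n)
    {N : ℕ} (hN1 : ∀ n ≥ N, e n ≤ 1) (hL : ∀ n ≥ N, e n ≠ 0 → e n ^ θ ≤ C * s n) :
    ∃ q, 0 < q ∧ q < 1 ∧ ∀ k, e (N + k) ≤ q ^ k := by
  have hb : 0 < a / C ^ 2 := by positivity
  refine ⟨1 / (1 + a / C ^ 2), by positivity, (div_lt_one (by positivity)).2 (by linarith), ?_⟩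
  intro k
  induction k with
  | zero => simpa using hN1 N le_rfl
  | succ k ih =>
    rw [pow_succ, mul_one_div, le_div_iff₀ (by positivity)]
    refine le_trans ?_ ih
    rcases eq_or_ne (e (N + k + 1)) 0 with h | h
    · rw [← add_assoc, h]; simpa using he _
    · have h3 := gap_rpow_le ha hC he hdesc (hL (N + k + 1) (by omega)) h
      have hpos : 0 < e (N + k + 1) := lt_of_le_of_ne (he _) h.symm
      have h4 : e (N + k + 1) ≤ e (N + k + 1) ^ (2 * θ) := by
        calc e (N + k + 1) = e (N + k + 1) ^ (1 : ℝ) := by simp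
          _ ≤ _ := Real.rpow_le_rpow_of_exponent_ge hpos (hN1 _ (by omega)) (by linarith)
      have h5 := mul_le_mul_of_nonneg_left h4 hb.le
      rw [← add_assoc]
      linarith

/-- On `[1, 2]` the convex power lies below its chord. -/
theorem one_add_rpow_le {p t : ℝ} (hp : 1 ≤ p) (h0 : 0 ≤ t) (h1 : t ≤ 1) :
    (1 + t) ^ p ≤ 1 + 2 ^ p * t := by
  have h := (convexOn_rpow hp).2 (by simp : (1 : ℝ) ∈ Set.Ici 0) (by simp : (2 : ℝ) ∈ Set.Ici 0)
    (by linarith : 0 ≤ 1 - t) h0 (by ring)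
  simp only [smul_eq_mul, mul_one, Real.one_rpow] at h
  have h2 : 1 - t + t * 2 = 1 + t := by ring
  rw [h2] at h
  linarith

/-- Comparison with `c_n = K (n + 1)^(-1/r)`: for large `K` this satisfies the reverse recursion
`c_{n+1} + b c_{n+1}^(1+r) ≥ c_n`, and `t ↦ t + b t^(1+r)` is increasing, so `e` can never overtake
`c`. -/
theorem exists_gap_power {r b : ℝ} (hr : 0 < r) (hr1 : r ≤ 1) (hb : 0 < b) (he : ∀ n, 0 ≤ e n)
    (h : ∀ n, e (n + 1) ≠ 0 → e (n + 1) + b * e (n + 1) ^ (1 + r) ≤ e n) :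
    ∃ K, 0 < K ∧ ∀ n : ℕ, e n ≤ K * ((n : ℝ) + 1) ^ (-(1 / r)) := by
  set p := 1 / r with hp
  have hp1 : 1 ≤ p := by rw [hp, le_div_iff₀ hr]; linarith
  -- Chosen so that `b M / (t + 1) ≥ 2^p / t` for `t ≥ 1`; one factor `2` absorbs `t + 1 ≤ 2t`, and
  -- `2^p` is the chord constant of `one_add_rpow_le`.
  set M : ℝ := 2 * 2 ^ p / b with hM
  have hM0 : 0 < M := by positivity
  set K := max (e 0) (M ^ p) with hKdef
  have hMp : 0 < M ^ p := Real.rpow_pos_of_pos hM0 _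
  have hK : 0 < K := lt_of_lt_of_le hMp (le_max_right _ _)
  have hKr : M ≤ K ^ r := by
    calc M = (M ^ p) ^ r := by
          rw [← Real.rpow_mul hM0.le, hp, one_div_mul_cancel hr.ne', Real.rpow_one]
      _ ≤ K ^ r := Real.rpow_le_rpow hMp.le (le_max_right _ _) hr.le
  refine ⟨K, hK, fun n => ?_⟩
  induction n with
  | zero => simp [hKdef]
  | succ n ih =>
    by_contra hcon
    rw [not_le] at hcon
    push_cast at hcon
    set t : ℝ := (n : ℝ) + 1 with ht
    have ht1 : 1 ≤ t := by rw [ht]; linarith [Nat.cast_nonneg (α := ℝ) n]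
    have ht0 : 0 < t := by linarith
    set c := K * (t + 1) ^ (-p) with hc
    have hc0 : 0 < c := by positivity
    have hne : e (n + 1) ≠ 0 := (hc0.trans hcon).ne'
    have h2 := h n hne
    have h3 : c * (1 + b * c ^ r) < e n := by
      have hce : c ^ r ≤ e (n + 1) ^ r := Real.rpow_le_rpow hc0.le hcon.le hr.le
      calc c * (1 + b * c ^ r) < e (n + 1) * (1 + b * c ^ r) := by gcongr
        _ ≤ e (n + 1) * (1 + b * e (n + 1) ^ r) := by
            have := he (n + 1); gcongr
        _ = e (n + 1) + b * e (n + 1) ^ (1 + r) := by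
            rw [Real.rpow_add (hc0.trans hcon), Real.rpow_one]; ring
        _ ≤ e n := h2
    have h4 : c ^ r = K ^ r * (t + 1)⁻¹ := by
      rw [hc, Real.mul_rpow hK.le (by positivity), ← Real.rpow_mul (by positivity), hp,
        neg_mul, one_div_mul_cancel hr.ne', Real.rpow_neg_one]
    have h5 : 2 ^ p * t⁻¹ ≤ b * c ^ r := by
      rw [h4]
      calc 2 ^ p * t⁻¹ ≤ 2 * 2 ^ p * (t + 1)⁻¹ := by
            have : t⁻¹ ≤ 2 * (t + 1)⁻¹ := by
              rw [← one_div, ← div_eq_mul_inv, div_le_div_iff₀ ht0 (by linarith)]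
              linarith
            have h2p : (0 : ℝ) < 2 ^ p := by positivity
            nlinarith
        _ = b * (M * (t + 1)⁻¹) := by rw [hM]; field_simp
        _ ≤ b * (K ^ r * (t + 1)⁻¹) := by gcongr
    have h6 : t ^ (-p) ≤ (t + 1) ^ (-p) * (1 + b * c ^ r) := by
      have h7 := one_add_rpow_le hp1 (t := t⁻¹) (by positivity) (inv_le_one_of_one_le₀ ht1)
      have h8 : 1 + t⁻¹ = (t + 1) / t := by field_simp
      rw [h8, Real.div_rpow (by linarith) ht0.le] at h7
      have h9 : (t + 1) ^ p / t ^ p ≤ 1 + b * c ^ r := by linarith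
      rw [Real.rpow_neg ht0.le, Real.rpow_neg (by linarith : (0 : ℝ) ≤ t + 1)]
      have hA : 0 < (t + 1) ^ p := by positivity
      have hB : 0 < t ^ p := by positivity
      calc (t ^ p)⁻¹ = ((t + 1) ^ p)⁻¹ * ((t + 1) ^ p / t ^ p) := by field_simp
        _ ≤ _ := by gcongr
    have h7 : K * t ^ (-p) ≤ c * (1 + b * c ^ r) := by
      calc K * t ^ (-p) ≤ K * ((t + 1) ^ (-p) * (1 + b * c ^ r)) := by gcongr
        _ = c * (1 + b * c ^ r) := by rw [hc]; ring
    linarith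

end RealSequences

/-! ### Minimizers of perturbed extended-valued functions -/

theorem Proper.coe_toReal {V : Type*} {ψ : V → EReal} (h : Proper ψ) {v : V} (hv : ψ v ≠ ⊤) :
    ((ψ v).toReal : EReal) = ψ v :=
  EReal.coe_toReal hv (h.1 v)

theorem ne_top_of_mem_argmin {V : Type*} {ψ : V → EReal} (h : Proper ψ) {r : V → ℝ} {a : V}
    (ha : a ∈ argmin (fun v => ψ v + (r v : EReal))) : ψ a ≠ ⊤ := by
  obtain ⟨b, hb⟩ := h.2
  intro hcon
  have h1 := ha b
  simp only [hcon, EReal.top_add_coe, top_le_iff] at h1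
  rw [← h.coe_toReal hb] at h1
  exact EReal.coe_ne_top _ (by rw [EReal.coe_add]; exact h1)

theorem toReal_add_le_of_mem_argmin {V : Type*} {ψ : V → EReal} (h : Proper ψ) {r : V → ℝ} {a : V}
    (ha : a ∈ argmin (fun v => ψ v + (r v : EReal))) {b : V} (hb : ψ b ≠ ⊤) :
    (ψ a).toReal + r a ≤ (ψ b).toReal + r b := by
  have h1 := ha b
  simp only at h1
  rw [← h.coe_toReal hb, ← h.coe_toReal (ne_top_of_mem_argmin h ha)] at h1
  exact_mod_cast h1

/-- A minimizer of `ψ + r` provides a minorant of `ψ` that touches it at `a` and is as smooth as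
`r`. All subgradients used later are gradients of such minorants. -/
theorem minorant_of_mem_argmin {V : Type*} {ψ : V → EReal} (h : Proper ψ) {r : V → ℝ} {a : V}
    (ha : a ∈ argmin (fun v => ψ v + (r v : EReal))) (b : V) :
    (((ψ a).toReal + r a - r b : ℝ) : EReal) ≤ ψ b := by
  rcases eq_or_ne (ψ b) ⊤ with hb | hb
  · rw [hb]; exact le_top
  · rw [← h.coe_toReal hb]
    have := toReal_add_le_of_mem_argmin h ha hb
    exact_mod_cast (by linarith)

/-- Values converge along minimizers of continuously perturbed lower semicontinuous functions. -/
theorem tendsto_toReal_of_mem_argmin {V : Type*} [TopologicalSpace V] {ψ : V → EReal} (h : Proper ψ)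
    (hlsc : LowerSemicontinuous ψ) {r : ℕ → V → ℝ} {ρ : V → ℝ} {a : ℕ → V} {a' : V} (ha : Tendsto a atTop (𝓝 a'))
    (hmin : ∀ k, a k ∈ argmin (fun v => ψ v + (r k v : EReal)))
    (hr : ∀ b, Tendsto (fun k => r k b) atTop (𝓝 (ρ b)))
    (hra : Tendsto (fun k => r k (a k)) atTop (𝓝 (ρ a'))) :
    ψ a' ≠ ⊤ ∧ Tendsto (fun k => (ψ (a k)).toReal) atTop (𝓝 (ψ a').toReal) := by
  have hfin : ∀ k, ψ (a k) ≠ ⊤ := fun k => ne_top_of_mem_argmin h (hmin k)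
  -- Comparison with a fixed competitor `b` bounds the values from above in the limit. Any `b` in
  -- the domain first shows that `ψ a'` is finite; then `b = a'` gives the sharp upper bound, and
  -- lower semicontinuity the lower one.
  have hub : ∀ b, ψ b ≠ ⊤ → ∀ c, (ψ b).toReal + ρ b - ρ a' < c →
      ∀ᶠ k in atTop, (ψ (a k)).toReal < c := by
    intro b hb c hc
    have := ((hr b).const_add (ψ b).toReal).sub hra
    filter_upwards [this.eventually_lt_const hc] with k hk
    linarith [toReal_add_le_of_mem_argmin h (hmin k) hb]
  have htop : ψ a' ≠ ⊤ := by
    obtain ⟨b, hb⟩ := h.2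
    set c := (ψ b).toReal + ρ b - ρ a' + 1 with hc
    have hmem : a' ∈ ψ ⁻¹' Set.Iic (c : EReal) := by
      refine (hlsc.isClosed_preimage _).mem_of_tendsto ha ?_
      filter_upwards [hub b hb c (by linarith)] with k hk
      simp only [Set.mem_preimage, Set.mem_Iic]
      rw [← h.coe_toReal (hfin k)]
      exact_mod_cast hk.le
    exact ne_top_of_le_ne_top (EReal.coe_ne_top c) hmem
  refine ⟨htop, tendsto_order.2 ⟨fun c hc => ?_, fun c hc => hub a' htop c (by linarith)⟩⟩
  have hc' : (c : EReal) < ψ a' := by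
    rw [← h.coe_toReal htop]; exact_mod_cast hc
  filter_upwards [ha.eventually (hlsc a' _ hc')] with k hk
  rw [← h.coe_toReal (hfin k)] at hk
  exact_mod_cast hk

/-! ### Subgradients from smooth minorants, and the descent lemma -/

section Variational

variable {V : Type*} [NormedAddCommGroup V] [InnerProductSpace ℝ V]

/-- The gradient of a differentiable minorant touching at `v` is a Fréchet subgradient. -/
theorem mem_frechetSubdiff_of_minorant {ψ : V → EReal} {φ : V → ℝ} {v d : V}
    (h : HasFDerivAt φ (innerSL ℝ d) v) (hv : ψ v = φ v) (hle : ∀ w, (φ w : EReal) ≤ ψ w) :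
    d ∈ frechetSubdiff ψ v := by
  refine ⟨by rw [hv]; exact EReal.coe_lt_top _, ?_⟩
  -- It suffices that every `c < 0` is eventually below the quotient; the first-order expansion of
  -- `φ` gives this with error `-c * ‖w - v‖`.
  rw [← EReal.ge_of_forall_gt_iff_ge]
  intro c hc
  have hc' : c < 0 := by exact_mod_cast hc
  refine le_liminf_of_le (by isBoundedDefault) ?_
  have hlo := (hasFDerivAt_iff_isLittleO.1 h).def (neg_pos.2 hc')
  filter_upwards [hlo.filter_mono nhdsWithin_le_nhds, self_mem_nhdsWithin] with w hw hne
  have hpos : 0 < ‖w - v‖ := norm_pos_iff.2 (sub_ne_zero.2 hne)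
  rw [EReal.le_div_iff_mul_le (by exact_mod_cast hpos) (EReal.coe_ne_top _), hv]
  rw [innerSL_apply_apply, Real.norm_eq_abs] at hw
  have hw' := (abs_le.1 hw).1
  calc (c : EReal) * ((‖w - v‖ : ℝ) : EReal)
      ≤ (φ w : EReal) - (φ v : EReal) - ((inner ℝ d (w - v) : ℝ) : EReal) := by
        norm_cast
        linarith
    _ ≤ _ := by
        exact EReal.sub_le_sub (EReal.sub_le_sub (hle w) le_rfl) le_rfl

theorem mem_limitingSubdiff_of_tendsto {ψ : V → EReal} {v d : V} {vs ds : ℕ → V}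
    (hv : ψ v < ⊤) (hvs : Tendsto vs atTop (𝓝 v)) (hds : Tendsto ds atTop (𝓝 d))
    (hψ : Tendsto (fun n => ψ (vs n)) atTop (𝓝 (ψ v)))
    (h : ∀ n, ds n ∈ frechetSubdiff ψ (vs n)) : d ∈ limitingSubdiff ψ v :=
  ⟨hv, vs, ds, hvs, hds, hψ, h⟩

theorem mem_limitingSubdiff_of_mem_frechetSubdiff {ψ : V → EReal} {v d : V}
    (h : d ∈ frechetSubdiff ψ v) : d ∈ limitingSubdiff ψ v :=
  mem_limitingSubdiff_of_tendsto h.1 tendsto_const_nhds tendsto_const_nhds tendsto_const_nhds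
    fun _ => h

/-- The Lipschitz bound is asked only along the segment from `a` to `b`, because `∇H` is Lipschitz
only on the convex sets that contain the iterates. The defect `G` below is antitone on `[0, 1]`. -/
theorem descent_of_lipschitz_segment [CompleteSpace V] {f : V → ℝ} {g : V → V} {L : ℝ} {a b : V}
    (hf : ∀ w, HasGradientAt f (g w) w)
    (hL : ∀ t ∈ Set.Icc (0 : ℝ) 1, ‖g (a + t • (b - a)) - g a‖ ≤ L * (t * ‖b - a‖)) :
    f b ≤ f a + inner ℝ (g a) (b - a) + L / 2 * ‖b - a‖ ^ 2 := by
  set G : ℝ → ℝ := fun t => f (a + t • (b - a)) - t * inner ℝ (g a) (b - a)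
    - L / 2 * ‖b - a‖ ^ 2 * t ^ 2 with hG
  have hder : ∀ t, HasDerivAt G (inner ℝ (g (a + t • (b - a)) - g a) (b - a)
      - L * ‖b - a‖ ^ 2 * t) t := by
    intro t
    have h1 : HasDerivAt (fun t : ℝ => a + t • (b - a)) (b - a) t := by
      simpa using ((hasDerivAt_id t).smul_const (b - a)).const_add a
    have h2 := (hf (a + t • (b - a))).hasFDerivAt.comp_hasDerivAt t h1
    have h3 := (h2.sub ((hasDerivAt_id t).mul_const (inner ℝ (g a) (b - a)))).sub
      ((hasDerivAt_pow 2 t).const_mul (L / 2 * ‖b - a‖ ^ 2))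
    refine h3.congr_deriv ?_
    rw [InnerProductSpace.toDual_apply_apply, inner_sub_left]
    push_cast
    ring
  have hanti : AntitoneOn G (Set.Icc 0 1) := by
    refine antitoneOn_of_deriv_nonpos (convex_Icc 0 1)
      (fun t _ => (hder t).continuousAt.continuousWithinAt)
      (fun t _ => (hder t).differentiableAt.differentiableWithinAt) fun t ht => ?_
    rw [interior_Icc] at ht
    rw [(hder t).deriv]
    have h1 := hL t ⟨ht.1.le, ht.2.le⟩
    have h2 := real_inner_le_norm (g (a + t • (b - a)) - g a) (b - a)
    have h3 := mul_le_mul_of_nonneg_right h1 (norm_nonneg (b - a))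
    nlinarith
  have := hanti (Set.left_mem_Icc.2 zero_le_one) (Set.right_mem_Icc.2 zero_le_one) zero_le_one
  simp only [hG] at this
  simp at this
  linarith

end Variational

/-! ### The smallest eigenvalue of `AAᵀ` -/

section Spectral

variable {V W : Type*} [NormedAddCommGroup V] [InnerProductSpace ℝ V] [FiniteDimensional ℝ V]
  [NormedAddCommGroup W] [InnerProductSpace ℝ W] [FiniteDimensional ℝ W]

theorem inner_comp_adjoint_self (A : V →L[ℝ] W) (v : W) :
    inner ℝ (A (ContinuousLinearMap.adjoint A v)) v = ‖ContinuousLinearMap.adjoint A v‖ ^ 2 := by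
  rw [← real_inner_self_eq_norm_sq]
  exact (ContinuousLinearMap.adjoint_inner_right A _ _).symm

theorem isSymmetric_comp_adjoint (A : V →L[ℝ] W) :
    ((A.comp (ContinuousLinearMap.adjoint A) : W →L[ℝ] W) : W →ₗ[ℝ] W).IsSymmetric := by
  intro v w
  change inner ℝ (A (ContinuousLinearMap.adjoint A v)) w
    = inner ℝ v (A (ContinuousLinearMap.adjoint A w))
  rw [← ContinuousLinearMap.adjoint_inner_right, ContinuousLinearMap.adjoint_inner_left]

/-- In finite dimension the infimum of the Rayleigh quotient of `AAᵀ` is an eigenvalue; `lambdaMin`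
is at most this infimum, hence at most the quotient at `w`. A trivial `W` has no eigenvalue, whence
`Nontrivial`. -/
theorem lambdaMin_mul_le [Nontrivial W] (A : V →L[ℝ] W)
    (w : W) :
    lambdaMin (A.comp (ContinuousLinearMap.adjoint A)) * ‖w‖ ^ 2
      ≤ ‖ContinuousLinearMap.adjoint A w‖ ^ 2 := by
  set T : W →ₗ[ℝ] W := ((A.comp (ContinuousLinearMap.adjoint A) : W →L[ℝ] W) : W →ₗ[ℝ] W) with hT
  have hTin : ∀ v : W, inner ℝ (T v) v = ‖ContinuousLinearMap.adjoint A v‖ ^ 2 :=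
    inner_comp_adjoint_self A
  have hsym : T.IsSymmetric := isSymmetric_comp_adjoint A
  rcases eq_or_ne w 0 with rfl | hw
  · simp
  have hpos : 0 < ‖w‖ ^ 2 := by positivity
  rw [← le_div_iff₀ hpos]
  have hfin : {l : ℝ | Module.End.HasEigenvalue T l}.Finite := Module.End.finite_hasEigenvalue T
  refine (csInf_le hfin.bddBelow hsym.hasEigenvalue_iInf_of_finiteDimensional).trans ?_
  refine (ciInf_le ?_ (⟨w, hw⟩ : {x : W // x ≠ 0})).trans ?_
  · refine ⟨0, ?_⟩
    rintro _ ⟨v, rfl⟩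
    simp only [hTin, RCLike.re_to_real]
    positivity
  · simp [hTin]

/-- There are finitely many eigenvalues, so the infimum has an eigenvector `v` and `λ‖v‖² = ‖Aᵀv‖²`.
If `v = Ax` and `Aᵀv = 0`, then `‖v‖² = ⟨Aᵀv, x⟩ = 0`. -/
theorem lambdaMin_pos [Nontrivial W] {A : V →L[ℝ] W}
    (hA : Function.Surjective A) :
    0 < lambdaMin (A.comp (ContinuousLinearMap.adjoint A)) := by
  set T : W →ₗ[ℝ] W := ((A.comp (ContinuousLinearMap.adjoint A) : W →L[ℝ] W) : W →ₗ[ℝ] W) with hT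
  have hsym : T.IsSymmetric := isSymmetric_comp_adjoint A
  have hfin : {l : ℝ | Module.End.HasEigenvalue T l}.Finite := Module.End.finite_hasEigenvalue T
  have hmem : lambdaMin (A.comp (ContinuousLinearMap.adjoint A))
      ∈ {l : ℝ | Module.End.HasEigenvalue T l} :=
    Set.Nonempty.csInf_mem ⟨_, hsym.hasEigenvalue_iInf_of_finiteDimensional⟩ hfin
  obtain ⟨v, hv⟩ := Module.End.HasEigenvalue.exists_hasEigenvector hmem
  have h1 : inner ℝ (T v) v = ‖ContinuousLinearMap.adjoint A v‖ ^ 2 := inner_comp_adjoint_self A v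
  rw [hv.apply_eq_smul, real_inner_smul_left, real_inner_self_eq_norm_sq] at h1
  have hv0 : 0 < ‖v‖ ^ 2 := by have := norm_pos_iff.2 hv.2; positivity
  have hne : ContinuousLinearMap.adjoint A v ≠ 0 := by
    intro h0
    obtain ⟨x, rfl⟩ := hA v
    have := ContinuousLinearMap.adjoint_inner_left A x (A x)
    rw [h0, inner_zero_left] at this
    exact hv.2 (inner_self_eq_zero.1 this.symm)
  have : 0 < ‖ContinuousLinearMap.adjoint A v‖ ^ 2 := by
    have := norm_pos_iff.2 hne; positivity
  rw [← h1] at this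
  exact pos_of_mul_pos_left this hv0.le

end Spectral

/-! ### Partial gradients of `H` -/

section Gradients

variable {P : Problem m q p}

theorem hasFDerivAt_H (hP : P.WellPosed) (x : E m) (y : E q) :
    HasFDerivAt (fun w : E m × E q => P.H w.1 w.2)
      (fderiv ℝ (fun w : E m × E q => P.H w.1 w.2) (x, y)) (x, y) :=
  (hP.smooth_H.differentiable one_ne_zero _).hasFDerivAt

theorem hasFDerivAt_H_left (hP : P.WellPosed) (x : E m) (y : E q) :
    HasFDerivAt (fun x' => P.H x' y)
      ((fderiv ℝ (fun w : E m × E q => P.H w.1 w.2) (x, y)).comp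
        (ContinuousLinearMap.inl ℝ (E m) (E q))) x :=
  HasFDerivAt.comp (g := fun w : E m × E q => P.H w.1 w.2) (f := fun x' => (x', y)) x
    (hasFDerivAt_H hP x y) (hasFDerivAt_prodMk_left x y)

theorem hasFDerivAt_H_right (hP : P.WellPosed) (x : E m) (y : E q) :
    HasFDerivAt (fun y' => P.H x y')
      ((fderiv ℝ (fun w : E m × E q => P.H w.1 w.2) (x, y)).comp
        (ContinuousLinearMap.inr ℝ (E m) (E q))) y :=
  HasFDerivAt.comp (g := fun w : E m × E q => P.H w.1 w.2) (f := fun y' => (x, y')) y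
    (hasFDerivAt_H hP x y) (hasFDerivAt_prodMk_right x y)

theorem hasGradientAt_gradX (hP : P.WellPosed) (x : E m) (y : E q) :
    HasGradientAt (fun x' => P.H x' y) (P.gradX x y) x :=
  (hasFDerivAt_H_left hP x y).differentiableAt.hasGradientAt

theorem hasGradientAt_gradY (hP : P.WellPosed) (x : E m) (y : E q) :
    HasGradientAt (fun y' => P.H x y') (P.gradY x y) y :=
  (hasFDerivAt_H_right hP x y).differentiableAt.hasGradientAt

theorem continuous_gradX (hP : P.WellPosed) :
    Continuous (fun w : E m × E q => P.gradX w.1 w.2) := by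
  have : (fun w : E m × E q => P.gradX w.1 w.2) = fun w =>
      (InnerProductSpace.toDual ℝ (E m)).symm
        ((fderiv ℝ (fun w : E m × E q => P.H w.1 w.2) w).comp
          (ContinuousLinearMap.inl ℝ (E m) (E q))) := by
    ext1 w
    rw [Problem.gradX, gradient, (hasFDerivAt_H_left hP w.1 w.2).fderiv]
  rw [this]
  exact (InnerProductSpace.toDual ℝ (E m)).symm.continuous.comp
    ((hP.smooth_H.continuous_fderiv one_ne_zero).clm_comp continuous_const)

theorem continuous_gradY (hP : P.WellPosed) :
    Continuous (fun w : E m × E q => P.gradY w.1 w.2) := by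
  have : (fun w : E m × E q => P.gradY w.1 w.2) = fun w =>
      (InnerProductSpace.toDual ℝ (E q)).symm
        ((fderiv ℝ (fun w : E m × E q => P.H w.1 w.2) w).comp
          (ContinuousLinearMap.inr ℝ (E m) (E q))) := by
    ext1 w
    rw [Problem.gradY, gradient, (hasFDerivAt_H_right hP w.1 w.2).fderiv]
  rw [this]
  exact (InnerProductSpace.toDual ℝ (E q)).symm.continuous.comp
    ((hP.smooth_H.continuous_fderiv one_ne_zero).clm_comp continuous_const)

theorem fderiv_H_apply (hP : P.WellPosed) (x : E m) (y : E q) (h : E m) (k : E q) :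
    fderiv ℝ (fun w : E m × E q => P.H w.1 w.2) (x, y) (h, k)
      = inner ℝ (P.gradX x y) h + inner ℝ (P.gradY x y) k := by
  have h1 := (hasGradientAt_gradX hP x y).hasFDerivAt.unique (hasFDerivAt_H_left hP x y)
  have h2 := (hasGradientAt_gradY hP x y).hasFDerivAt.unique (hasFDerivAt_H_right hP x y)
  rw [← InnerProductSpace.toDual_apply_apply, ← InnerProductSpace.toDual_apply_apply, h1, h2]
  simp only [ContinuousLinearMap.comp_apply, ContinuousLinearMap.inl_apply,
    ContinuousLinearMap.inr_apply]
  rw [← map_add]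
  simp

end Gradients

/-! ### One-step inequalities in Hilbert space -/

section Hilbert

variable {V W : Type*} [NormedAddCommGroup V] [InnerProductSpace ℝ V]
  [NormedAddCommGroup W] [InnerProductSpace ℝ W]

theorem norm_sq_convex_comb_le {σ : ℝ} (h0 : 0 ≤ σ) (h1 : σ ≤ 1) (v w : V) :
    ‖(1 - σ) • w + σ • v‖ ^ 2 ≤ (1 - σ) * ‖w‖ ^ 2 + σ * ‖v‖ ^ 2 := by
  have h := norm_add_le ((1 - σ) • w) (σ • v)
  rw [norm_smul, norm_smul, Real.norm_of_nonneg h0, Real.norm_of_nonneg (sub_nonneg.2 h1)] at h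
  have h2 := pow_le_pow_left₀ (norm_nonneg _) h 2
  have h3 : 0 ≤ σ * (1 - σ) := mul_nonneg h0 (sub_nonneg.2 h1)
  nlinarith [mul_nonneg h3 (sq_nonneg (‖w‖ - ‖v‖))]

/-- In the expanded square the cross term `-2τβ‖Av‖²` absorbs `β²‖AᵀAv‖² ≤ β (β‖A‖²) ‖Av‖²`; this is
the role of `2τ ≥ β‖A‖²`. -/
theorem norm_smul_id_sub_le [CompleteSpace V] [CompleteSpace W] (A : V →L[ℝ] W) {β τ : ℝ}
    (hβ : 0 ≤ β) (hτ : 0 ≤ τ) (h : β * ‖A‖ ^ 2 ≤ 2 * τ) (v : V) :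
    ‖τ • v - β • ContinuousLinearMap.adjoint A (A v)‖ ≤ τ * ‖v‖ := by
  apply le_of_sq_le_sq _ (by positivity)
  rw [norm_sub_sq_real, norm_smul, norm_smul, real_inner_smul_left, real_inner_smul_right,
    ContinuousLinearMap.adjoint_inner_right, real_inner_self_eq_norm_sq,
    Real.norm_of_nonneg hβ, Real.norm_of_nonneg hτ]
  have h1 : ‖ContinuousLinearMap.adjoint A (A v)‖ ≤ ‖A‖ * ‖A v‖ := by
    have := (ContinuousLinearMap.adjoint A).le_opNorm (A v)
    rwa [LinearIsometryEquiv.norm_map] at this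
  have h2 := pow_le_pow_left₀ (norm_nonneg _) h1 2
  have h3 : β ^ 2 * ‖ContinuousLinearMap.adjoint A (A v)‖ ^ 2
      ≤ β * (2 * τ) * ‖A v‖ ^ 2 := by
    calc β ^ 2 * ‖ContinuousLinearMap.adjoint A (A v)‖ ^ 2
        ≤ β ^ 2 * (‖A‖ * ‖A v‖) ^ 2 := by gcongr
      _ = β * (β * ‖A‖ ^ 2) * ‖A v‖ ^ 2 := by ring
      _ ≤ β * (2 * τ) * ‖A v‖ ^ 2 := by gcongr
  nlinarith

/-- One step of the algorithm nearly decreases the augmented Lagrangian. -/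
theorem augmented_lagrangian_step {Y : Type*} [NormedAddCommGroup Y] [InnerProductSpace ℝ Y]
    [CompleteSpace V] [CompleteSpace W]
    (A : V →L[ℝ] W) {μ β τ σ L F₀ F₁ G₀ G₁ H₀₀ H₀₁ H₁₁ : ℝ} {x₀ x₁ gx : V} {y₀ y₁ gy : Y}
    {z₀ z₁ u₀ u₁ : W} (hβ : 0 < β) (hσ : 0 < σ)
    (hy : G₁ + (inner ℝ gy y₁ + μ / 2 * ‖y₁ - y₀‖ ^ 2)
      ≤ G₀ + (inner ℝ gy y₀ + μ / 2 * ‖y₀ - y₀‖ ^ 2))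
    (hz : F₁ + (inner ℝ u₀ (A x₀ - z₁) + β / 2 * ‖A x₀ - z₁‖ ^ 2)
      ≤ F₀ + (inner ℝ u₀ (A x₀ - z₀) + β / 2 * ‖A x₀ - z₀‖ ^ 2))
    (hHy : H₀₁ ≤ H₀₀ + inner ℝ gy (y₁ - y₀) + L / 2 * ‖y₁ - y₀‖ ^ 2)
    (hHx : H₁₁ ≤ H₀₁ + inner ℝ gx (x₁ - x₀) + L / 2 * ‖x₁ - x₀‖ ^ 2)
    (hx : gx = -(τ • (x₁ - x₀)) - ContinuousLinearMap.adjoint A u₀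
      - β • ContinuousLinearMap.adjoint A (A x₀ - z₁))
    (hu : u₁ - u₀ = (σ * β) • (A x₁ - z₁)) :
    F₁ + G₁ + (H₁₁ + inner ℝ u₁ (A x₁ - z₁) + β / 2 * ‖A x₁ - z₁‖ ^ 2)
      + (τ - (L + β * ‖A‖ ^ 2) / 2) * ‖x₁ - x₀‖ ^ 2 + (μ - L) / 2 * ‖y₁ - y₀‖ ^ 2
    ≤ F₀ + G₀ + (H₀₀ + inner ℝ u₀ (A x₀ - z₀) + β / 2 * ‖A x₀ - z₀‖ ^ 2)
      + 1 / (σ * β) * ‖u₁ - u₀‖ ^ 2 := by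
  have e1 : A x₁ - z₁ = (A x₀ - z₁) + A (x₁ - x₀) := by rw [map_sub]; abel
  -- The only increase in the whole step: the dual update raises the Lagrangian by exactly this
  -- amount.
  have e2 : inner ℝ u₁ (A x₁ - z₁)
      = inner ℝ u₀ (A x₁ - z₁) + 1 / (σ * β) * ‖u₁ - u₀‖ ^ 2 := by
    have : u₁ = u₀ + (u₁ - u₀) := by abel
    rw [this, inner_add_left, add_sub_cancel_left, hu, real_inner_smul_left,
      real_inner_self_eq_norm_sq, norm_smul, Real.norm_of_nonneg (by positivity)]
    field_simp
  -- The linear terms here cancel against those in the expansion of the Lagrangian around `x₀`,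
  -- leaving `-τ‖x₁ - x₀‖²` against second-order remainders.
  have e3 : inner ℝ gx (x₁ - x₀) = -(τ * ‖x₁ - x₀‖ ^ 2) - inner ℝ u₀ (A (x₁ - x₀))
      - β * inner ℝ (A x₀ - z₁) (A (x₁ - x₀)) := by
    rw [hx, inner_sub_left, inner_sub_left, inner_neg_left, real_inner_smul_left,
      real_inner_smul_left, ContinuousLinearMap.adjoint_inner_left,
      ContinuousLinearMap.adjoint_inner_left, real_inner_self_eq_norm_sq]
  have e4 : inner ℝ u₀ (A x₁ - z₁) = inner ℝ u₀ (A x₀ - z₁) + inner ℝ u₀ (A (x₁ - x₀)) := by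
    rw [e1, inner_add_right]
  have e5 : ‖A x₁ - z₁‖ ^ 2 = ‖A x₀ - z₁‖ ^ 2 + 2 * inner ℝ (A x₀ - z₁) (A (x₁ - x₀))
      + ‖A (x₁ - x₀)‖ ^ 2 := by
    rw [e1, norm_add_sq_real]
  have e6 : β / 2 * ‖A (x₁ - x₀)‖ ^ 2 ≤ β / 2 * (‖A‖ ^ 2 * ‖x₁ - x₀‖ ^ 2) := by
    rw [← mul_pow]
    gcongr
    exact A.le_opNorm _
  rw [inner_sub_right] at hHy
  rw [sub_self, norm_zero] at hy
  rw [e2, e4, e5]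
  rw [e3] at hHx
  linarith

end Hilbert

/-! ### Sufficient decrease of `Ψ` along the iterates -/

section Iterates

/-- The `n`-th point at which the regularized augmented Lagrangian is evaluated. -/
def iter (x : ℕ → E m) (y : ℕ → E q) (z : ℕ → E p) (u : ℕ → E p) (n : ℕ) : R m q p :=
  mkR (x (n + 1)) (y (n + 1)) (z (n + 1)) (u (n + 1)) (x n) (u n)

/-- The total length of the `n`-th step in the variables `x`, `y`, `u`. -/
def stepLen (x : ℕ → E m) (y : ℕ → E q) (u : ℕ → E p) (n : ℕ) : ℝ :=
  ‖x (n + 1) - x n‖ + ‖y (n + 1) - y n‖ + ‖u (n + 1) - u n‖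

/-- The real value of the regularized augmented Lagrangian at the `n`-th point. -/
def psiSeq (P : Problem m q p) (c : Params) (x : ℕ → E m) (y : ℕ → E q) (z : ℕ → E p)
    (u : ℕ → E p) (n : ℕ) : ℝ :=
  (P.F (z (n + 1))).toReal + (P.G (y (n + 1))).toReal +
    (P.H (x (n + 1)) (y (n + 1)) + inner ℝ (u (n + 1)) (P.A (x (n + 1)) - z (n + 1))
      + c.β / 2 * ‖P.A (x (n + 1)) - z (n + 1)‖ ^ 2
      + P.C₀ c * ‖P.At (u (n + 1) - u n) + c.σ • P.B c (x (n + 1) - x n)‖ ^ 2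
      + P.C₁ c * ‖x (n + 1) - x n‖ ^ 2)

variable {P : Problem m q p} {c : Params} {x : ℕ → E m} {y : ℕ → E q} {z : ℕ → E p} {u : ℕ → E p}

theorem stepLen_nonneg (n : ℕ) : 0 ≤ stepLen x y u n := by
  unfold stepLen; positivity

theorem F_iter_ne_top (hP : P.WellPosed) (hgen : P.IsGenerated c x y z u) (n : ℕ) :
    P.F (z (n + 1)) ≠ ⊤ :=
  ne_top_of_mem_argmin hP.proper_F (hgen n).2.1

theorem G_iter_ne_top (hP : P.WellPosed) (hgen : P.IsGenerated c x y z u) (n : ℕ) :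
    P.G (y (n + 1)) ≠ ⊤ :=
  ne_top_of_mem_argmin hP.proper_G (hgen n).1

theorem Psi_iter (hP : P.WellPosed) (hgen : P.IsGenerated c x y z u) (n : ℕ) :
    P.Psi c (iter x y z u n) = psiSeq P c x y z u n := by
  have : P.Psi c (iter x y z u n)
      = P.PsiFun c (x (n + 1)) (y (n + 1)) (z (n + 1)) (u (n + 1)) (x n) (u n) := rfl
  rw [this, Problem.PsiFun, ← hP.proper_F.coe_toReal (F_iter_ne_top hP hgen n),
    ← hP.proper_G.coe_toReal (G_iter_ne_top hP hgen n), psiSeq]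
  norm_cast

theorem u_step (hgen : P.IsGenerated c x y z u) (n : ℕ) :
    u (n + 1) - u n = (c.σ * c.β) • (P.A (x (n + 1)) - z (n + 1)) := by
  rw [(hgen n).2.2.2]; abel

theorem x_step (hgen : P.IsGenerated c x y z u) (hass : P.Assumptions c x y z u) (n : ℕ) :
    P.gradX (x n) (y (n + 1)) = -(c.τ • (x (n + 1) - x n)) - P.At (u n)
      - c.β • P.At (P.A (x n) - z (n + 1)) := by
  have h : x (n + 1) - x n = -(c.τ⁻¹ • (P.gradX (x n) (y (n + 1)) + P.At (u n)
      + c.β • P.At (P.A (x n) - z (n + 1)))) := by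
    rw [(hgen n).2.2.1]; abel
  rw [h, smul_neg, smul_smul, mul_inv_cancel₀ hass.τ_pos.ne']
  module

theorem B_apply (v : E m) : P.B c v = c.τ • v - c.β • P.At (P.A v) := rfl

/-- The auxiliary quantity `Aᵀ (u' - u) + σ B (x' - x)` along the iterates. -/
theorem aux_eq (hgen : P.IsGenerated c x y z u) (hass : P.Assumptions c x y z u) (n : ℕ) :
    P.At (u (n + 1) - u n) + c.σ • P.B c (x (n + 1) - x n)
      = -(c.σ • (P.gradX (x n) (y (n + 1)) + P.At (u n))) := by
  rw [u_step hgen, B_apply, x_step hgen hass n]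
  simp only [map_sub, map_smul]
  module

/-- The indices are independent because a product set also contains mixed pairs such as `(x n, y (n
+ 1))`, at which the algorithm evaluates `∇ₓH`. -/
theorem lipschitz_iter (hass : P.Assumptions c x y z u) (i j k l : ℕ) :
    √(‖P.gradX (x i) (y k) - P.gradX (x j) (y l)‖ ^ 2
      + ‖P.gradY (x i) (y k) - P.gradY (x j) (y l)‖ ^ 2)
        ≤ c.L * √(‖x i - x j‖ ^ 2 + ‖y k - y l‖ ^ 2) := by
  obtain ⟨B₁, B₂, -, -, -, -, hm, hL⟩ := hass.lipschitz_grad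
  exact hL _ (hm i).1 _ (hm j).1 _ (hm k).2 _ (hm l).2

theorem sqrt_sq_add_sq_le {a b : ℝ} (ha : 0 ≤ a) (hb : 0 ≤ b) : √(a ^ 2 + b ^ 2) ≤ a + b := by
  rw [Real.sqrt_le_left (by positivity)]
  nlinarith

theorem gradX_lipschitz (hass : P.Assumptions c x y z u) (i j k l : ℕ) :
    ‖P.gradX (x i) (y k) - P.gradX (x j) (y l)‖ ≤ c.L * (‖x i - x j‖ + ‖y k - y l‖) :=
  (Real.le_sqrt_of_sq_le (by simp)).trans ((lipschitz_iter hass i j k l).trans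
    (mul_le_mul_of_nonneg_left (sqrt_sq_add_sq_le (norm_nonneg _) (norm_nonneg _)) hass.L_pos.le))

theorem gradY_lipschitz (hass : P.Assumptions c x y z u) (i j k l : ℕ) :
    ‖P.gradY (x i) (y k) - P.gradY (x j) (y l)‖ ≤ c.L * (‖x i - x j‖ + ‖y k - y l‖) :=
  (Real.le_sqrt_of_sq_le (by simp)).trans ((lipschitz_iter hass i j k l).trans
    (mul_le_mul_of_nonneg_left (sqrt_sq_add_sq_le (norm_nonneg _) (norm_nonneg _)) hass.L_pos.le))

theorem descent_H_left (hP : P.WellPosed) (hass : P.Assumptions c x y z u) (i j k : ℕ) :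
    P.H (x i) (y k) ≤ P.H (x j) (y k) + inner ℝ (P.gradX (x j) (y k)) (x i - x j)
      + c.L / 2 * ‖x i - x j‖ ^ 2 := by
  refine descent_of_lipschitz_segment (f := fun x' => P.H x' (y k))
    (fun w => hasGradientAt_gradX hP w (y k)) fun t ht => ?_
  obtain ⟨B₁, B₂, hB₁, -, -, -, hm, hL⟩ := hass.lipschitz_grad
  have hmem : x j + t • (x i - x j) ∈ B₁ :=
    hB₁.add_smul_sub_mem (hm j).1 (hm i).1 ht
  have h := hL _ hmem _ (hm j).1 _ (hm k).2 _ (hm k).2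
  rw [add_sub_cancel_left, sub_self, norm_zero, norm_smul, Real.norm_of_nonneg ht.1] at h
  refine (Real.le_sqrt_of_sq_le (le_add_of_nonneg_right (sq_nonneg _))).trans (h.trans_eq ?_)
  rw [zero_pow two_ne_zero, add_zero, Real.sqrt_sq (mul_nonneg ht.1 (norm_nonneg _))]

theorem descent_H_right (hP : P.WellPosed) (hass : P.Assumptions c x y z u) (i j k : ℕ) :
    P.H (x k) (y i) ≤ P.H (x k) (y j) + inner ℝ (P.gradY (x k) (y j)) (y i - y j)
      + c.L / 2 * ‖y i - y j‖ ^ 2 := by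
  refine descent_of_lipschitz_segment (f := fun y' => P.H (x k) y')
    (fun w => hasGradientAt_gradY hP (x k) w) fun t ht => ?_
  obtain ⟨B₁, B₂, -, hB₂, -, -, hm, hL⟩ := hass.lipschitz_grad
  have hmem : y j + t • (y i - y j) ∈ B₂ :=
    hB₂.add_smul_sub_mem (hm j).2 (hm i).2 ht
  have h := hL _ (hm k).1 _ (hm k).1 _ hmem _ (hm j).2
  rw [add_sub_cancel_left, sub_self, norm_zero, norm_smul, Real.norm_of_nonneg ht.1] at h
  refine (Real.le_sqrt_of_sq_le (le_add_of_nonneg_left (sq_nonneg _))).trans (h.trans_eq ?_)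
  rw [zero_pow two_ne_zero, zero_add, Real.sqrt_sq (mul_nonneg ht.1 (norm_nonneg _))]

theorem lam_pos (hp : 0 < p) (hA : Function.Surjective P.A) : 0 < P.lam := by
  have : Nontrivial (E p) := by
    have : Nonempty (Fin p) := ⟨⟨0, hp⟩⟩
    infer_instance
  exact lambdaMin_pos hA

theorem lam_mul_le (hp : 0 < p) (v : E p) : P.lam * ‖v‖ ^ 2 ≤ ‖P.At v‖ ^ 2 := by
  have : Nontrivial (E p) := by
    have : Nonempty (Fin p) := ⟨⟨0, hp⟩⟩
    infer_instance
  exact lambdaMin_mul_le P.A v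

theorem norm_B_le (hass : P.Assumptions c x y z u) (v : E m) : ‖P.B c v‖ ≤ c.τ * ‖v‖ :=
  norm_smul_id_sub_le P.A hass.β_pos.le hass.τ_pos.le hass.two_τ v

/-- By `aux_eq` the auxiliary vector is `w_n = -σ (∇ₓH(x_n, y_{n+1}) + Aᵀu_n)`. Subtracting
consecutive instances and replacing `Aᵀ(u_{n+1} - u_n)` by `w_n - σB(x_{n+1} - x_n)` turns `w_{n+1}`
into a convex combination of `w_n` and a vector `v` of the size of the increments. -/
theorem aux_contraction (hgen : P.IsGenerated c x y z u) (hass : P.Assumptions c x y z u)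
    (n : ℕ) :
    ‖P.At (u (n + 2) - u (n + 1)) + c.σ • P.B c (x (n + 2) - x (n + 1))‖ ^ 2
      ≤ (1 - c.σ) * ‖P.At (u (n + 1) - u n) + c.σ • P.B c (x (n + 1) - x n)‖ ^ 2
        + c.σ * (2 * (c.σ * c.τ + c.L * √2) ^ 2 * ‖x (n + 1) - x n‖ ^ 2
          + 4 * c.L ^ 2 * ‖y (n + 2) - y (n + 1)‖ ^ 2) := by
  set v := c.σ • P.B c (x (n + 1) - x n)
    - (P.gradX (x (n + 1)) (y (n + 2)) - P.gradX (x n) (y (n + 1))) with hv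
  have h1 : P.At (u (n + 2) - u (n + 1)) + c.σ • P.B c (x (n + 2) - x (n + 1))
      = (1 - c.σ) • (P.At (u (n + 1) - u n) + c.σ • P.B c (x (n + 1) - x n)) + c.σ • v := by
    have e1 := aux_eq hgen hass (n + 1)
    have e0 := aux_eq hgen hass n
    have e2 : P.At (u (n + 1)) = P.At (u n) + P.At (u (n + 1) - u n) := by
      rw [map_sub]; abel
    have e3 : P.At (u (n + 1) - u n) = -(c.σ • (P.gradX (x n) (y (n + 1)) + P.At (u n)))
        - c.σ • P.B c (x (n + 1) - x n) := by rw [← e0]; abel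
    rw [e1, e0, e2, e3, hv]
    module
  have h2 : ‖v‖ ≤ (c.σ * c.τ + c.L) * ‖x (n + 1) - x n‖ + c.L * ‖y (n + 2) - y (n + 1)‖ := by
    have e1 := norm_sub_le (c.σ • P.B c (x (n + 1) - x n))
      (P.gradX (x (n + 1)) (y (n + 2)) - P.gradX (x n) (y (n + 1)))
    have e2 := gradX_lipschitz hass (n + 1) n (n + 2) (n + 1)
    have e3 := mul_le_mul_of_nonneg_left (norm_B_le hass (x (n + 1) - x n)) hass.σ_pos.le
    rw [norm_smul, Real.norm_of_nonneg hass.σ_pos.le] at e1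
    linarith
  have hL := hass.L_pos
  have hστ : 0 < c.σ * c.τ := mul_pos hass.σ_pos hass.τ_pos
  -- The iterates satisfy the bound with `L`; it is weakened to `L√2` only to match `C₁`.
  have h3 : (c.σ * c.τ + c.L) ^ 2 ≤ (c.σ * c.τ + c.L * √2) ^ 2 := by
    have : 1 ≤ √2 := Real.one_le_sqrt.2 (by norm_num)
    gcongr
    nlinarith
  have h4 : ‖v‖ ^ 2 ≤ 2 * (c.σ * c.τ + c.L * √2) ^ 2 * ‖x (n + 1) - x n‖ ^ 2
      + 4 * c.L ^ 2 * ‖y (n + 2) - y (n + 1)‖ ^ 2 := by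
    have e1 := pow_le_pow_left₀ (norm_nonneg _) h2 2
    have e2 := mul_le_mul_of_nonneg_right h3 (sq_nonneg ‖x (n + 1) - x n‖)
    have e3 := sq_nonneg ((c.σ * c.τ + c.L) * ‖x (n + 1) - x n‖ - c.L * ‖y (n + 2) - y (n + 1)‖)
    have e4 := sq_nonneg (c.L * ‖y (n + 2) - y (n + 1)‖)
    nlinarith
  rw [h1]
  refine (norm_sq_convex_comb_le hass.σ_pos.le hass.σ_le_one v _).trans ?_
  have := mul_le_mul_of_nonneg_left h4 hass.σ_pos.le
  linarith

/-- The Lagrangian step loses `‖Δu‖² / (σβ)`. Twice that quantity is bounded through `λ‖Δu‖² ≤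
‖AᵀΔu‖²` and `aux_contraction`: one copy cancels the loss, the other survives as the `C₄` term. -/
theorem psi_descent (hp : 0 < p) (hP : P.WellPosed) (hgen : P.IsGenerated c x y z u)
    (hass : P.Assumptions c x y z u) (n : ℕ) :
    psiSeq P c x y z u (n + 1) + P.C₂ c * ‖x (n + 2) - x (n + 1)‖ ^ 2
      + P.C₃ c * ‖y (n + 2) - y (n + 1)‖ ^ 2 + Problem.C₄ c * ‖u (n + 2) - u (n + 1)‖ ^ 2
      ≤ psiSeq P c x y z u n := by
  have hβ := hass.β_pos
  have hσ := hass.σ_pos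
  have hτ := hass.τ_pos
  have hL := hass.L_pos
  have hlam := lam_pos (P := P) hp hass.surjective_A
  have hstep := augmented_lagrangian_step P.A (μ := c.μ) (τ := c.τ) (L := c.L) hβ hσ
    (toReal_add_le_of_mem_argmin hP.proper_G (hgen (n + 1)).1 (G_iter_ne_top hP hgen n))
    (toReal_add_le_of_mem_argmin hP.proper_F (hgen (n + 1)).2.1 (F_iter_ne_top hP hgen n))
    (descent_H_right hP hass (n + 2) (n + 1) (n + 1))
    (descent_H_left hP hass (n + 2) (n + 1) (n + 2))
    (x_step hgen hass (n + 1)) (u_step hgen (n + 1))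
  have hcon := aux_contraction hgen hass n
  set w₀ := P.At (u (n + 1) - u n) + c.σ • P.B c (x (n + 1) - x n) with hw₀
  set w₁ := P.At (u (n + 2) - u (n + 1)) + c.σ • P.B c (x (n + 2) - x (n + 1)) with hw₁
  have hAu : P.lam * ‖u (n + 2) - u (n + 1)‖ ^ 2
      ≤ 2 * ‖w₁‖ ^ 2 + 2 * c.σ ^ 2 * c.τ ^ 2 * ‖x (n + 2) - x (n + 1)‖ ^ 2 := by
    refine (lam_mul_le hp _).trans ?_
    have e1 : P.At (u (n + 2) - u (n + 1)) = w₁ - c.σ • P.B c (x (n + 2) - x (n + 1)) := by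
      rw [hw₁]; abel
    have e2 := norm_sub_le w₁ (c.σ • P.B c (x (n + 2) - x (n + 1)))
    have e3 := mul_le_mul_of_nonneg_left (norm_B_le hass (x (n + 2) - x (n + 1))) hσ.le
    rw [norm_smul, Real.norm_of_nonneg hσ.le] at e2
    have e4 : ‖P.At (u (n + 2) - u (n + 1))‖
        ≤ ‖w₁‖ + c.σ * (c.τ * ‖x (n + 2) - x (n + 1)‖) := by rw [e1]; linarith
    have e5 := pow_le_pow_left₀ (norm_nonneg _) e4 2
    nlinarith [sq_nonneg (‖w₁‖ - c.σ * (c.τ * ‖x (n + 2) - x (n + 1)‖))]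
  set a₀ := ‖x (n + 1) - x n‖ ^ 2 with ha₀
  set a₁ := ‖x (n + 2) - x (n + 1)‖ ^ 2 with ha₁
  set b₁ := ‖y (n + 2) - y (n + 1)‖ ^ 2 with hb₁
  set d₁ := ‖u (n + 2) - u (n + 1)‖ ^ 2 with hd₁
  have ha₁0 : 0 ≤ a₁ := sq_nonneg _
  have hb₁0 : 0 ≤ b₁ := sq_nonneg _
  have hk : 0 < c.σ * c.β * P.lam := by positivity
  have hdu : 2 / (c.σ * c.β) * d₁ ≤ P.C₀ c * (‖w₀‖ ^ 2 - ‖w₁‖ ^ 2) + P.C₁ c * a₀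
      + 16 * c.L ^ 2 / (c.σ * c.β * P.lam) * b₁
      + 4 * c.σ * c.τ ^ 2 / (c.β * P.lam) * a₁ := by
    have e0 : 2 / (c.σ * c.β) * d₁ = 2 / (c.σ * c.β * P.lam) * (P.lam * d₁) := by field_simp
    have e1 : 2 / (c.σ * c.β) * d₁
        ≤ 2 / (c.σ * c.β * P.lam) * (2 * ‖w₁‖ ^ 2 + 2 * c.σ ^ 2 * c.τ ^ 2 * a₁) := by
      rw [e0]; gcongr
    -- Moving `(1 - σ)‖w₁‖²` across the contraction makes the `w` part telescope. Multiplied by `4 /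
    -- (σβλ)`, it produces `C₀`, `C₁` and the `16L²` term of `C₃`.
    have e2 : ‖w₁‖ ^ 2 ≤ (1 - c.σ) / c.σ * (‖w₀‖ ^ 2 - ‖w₁‖ ^ 2)
        + (2 * (c.σ * c.τ + c.L * √2) ^ 2 * a₀ + 4 * c.L ^ 2 * b₁) := by
      rw [← mul_le_mul_iff_right₀ hσ, mul_add, ← mul_assoc, mul_div_cancel₀ _ hσ.ne']
      linarith
    calc 2 / (c.σ * c.β) * d₁
        ≤ 2 / (c.σ * c.β * P.lam) * (2 * ‖w₁‖ ^ 2 + 2 * c.σ ^ 2 * c.τ ^ 2 * a₁) := e1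
      _ ≤ 2 / (c.σ * c.β * P.lam) * (2 * ((1 - c.σ) / c.σ * (‖w₀‖ ^ 2 - ‖w₁‖ ^ 2)
          + (2 * (c.σ * c.τ + c.L * √2) ^ 2 * a₀ + 4 * c.L ^ 2 * b₁))
          + 2 * c.σ ^ 2 * c.τ ^ 2 * a₁) := by gcongr
      _ = _ := by
        rw [Problem.C₀, Problem.C₁]
        field_simp
        ring
  have hsq : 1 ≤ √2 := Real.one_le_sqrt.2 (by norm_num)
  have hL2 : c.L ≤ c.L * √2 := by nlinarith
  have h2 : P.C₂ c * a₁ + 4 * c.σ * c.τ ^ 2 / (c.β * P.lam) * a₁ + P.C₁ c * a₁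
      ≤ (c.τ - (c.L + c.β * ‖P.A‖ ^ 2) / 2) * a₁ := by
    rw [← add_mul, ← add_mul]
    refine mul_le_mul_of_nonneg_right ?_ ha₁0
    rw [Problem.C₂, Problem.C₁]
    linarith
  have h3 : P.C₃ c * b₁ + 16 * c.L ^ 2 / (c.σ * c.β * P.lam) * b₁ ≤ (c.μ - c.L) / 2 * b₁ := by
    rw [← add_mul]
    refine mul_le_mul_of_nonneg_right ?_ hb₁0
    rw [Problem.C₃]
    linarith
  have h4 : Problem.C₄ c * d₁ + 1 / (c.σ * c.β) * d₁ = 2 / (c.σ * c.β) * d₁ := by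
    rw [Problem.C₄]; ring
  rw [psiSeq, psiSeq]
  simp only [add_assoc, one_add_one_eq_two] at hstep ⊢
  simp only [← hw₀, ← hw₁, ← ha₀, ← ha₁] at hstep ⊢
  linarith

end Iterates

/-! ### Subgradients of `F`, `G` and `Ψ` at the iterates -/

section Subgradients

theorem hasFDerivAt_const_sub_linear_add_sq {V : Type*} [NormedAddCommGroup V]
    [InnerProductSpace ℝ V] (k μ : ℝ) (g b a : V) :
    HasFDerivAt (fun v => k - (inner ℝ g v + μ / 2 * ‖v - b‖ ^ 2))
      (innerSL ℝ (-g - μ • (a - b))) a := by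
  have h1 : HasFDerivAt (fun v => inner ℝ g v) (innerSL ℝ g) a := (innerSL ℝ g).hasFDerivAt
  have h2 := (((hasFDerivAt_id a).sub_const b).norm_sq).const_mul (μ / 2)
  refine ((h1.add h2).const_sub k).congr_fderiv ?_
  ext v
  simp
  ring

theorem hasFDerivAt_const_sub_penalty {V : Type*} [NormedAddCommGroup V]
    [InnerProductSpace ℝ V] (k β : ℝ) (u b a : V) :
    HasFDerivAt (fun v => k - (inner ℝ u (b - v) + β / 2 * ‖b - v‖ ^ 2))
      (innerSL ℝ (u + β • (b - a))) a := by
  have h0 : HasFDerivAt (fun v => b - v) (-ContinuousLinearMap.id ℝ V) a :=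
    (hasFDerivAt_id a).const_sub b
  have h1 : HasFDerivAt (fun v => inner ℝ u (b - v)) (-innerSL ℝ u) a :=
    ((innerSL ℝ u).hasFDerivAt.comp a h0).congr_fderiv (by ext v; simp)
  have h2 := h0.norm_sq.const_mul (β / 2)
  refine ((h1.add h2).const_sub k).congr_fderiv ?_
  ext v
  simp
  ring

/-- The gradient of the smooth part of the regularized augmented Lagrangian. -/
def smoothGrad (P : Problem m q p) (c : Params) (x : E m) (y : E q) (z u : E p) (x' : E m)
    (u' : E p) : R m q p :=
  mkR
    (P.gradX x y + P.At u + c.β • P.At (P.A x - z)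
      + (2 * P.C₀ c * c.σ) • ContinuousLinearMap.adjoint (P.B c)
          (P.At (u - u') + c.σ • P.B c (x - x'))
      + (2 * P.C₁ c) • (x - x'))
    (P.gradY x y)
    (-u - c.β • (P.A x - z))
    (P.A x - z + (2 * P.C₀ c) • P.A (P.At (u - u') + c.σ • P.B c (x - x')))
    (-((2 * P.C₀ c * c.σ) • ContinuousLinearMap.adjoint (P.B c)
          (P.At (u - u') + c.σ • P.B c (x - x')))
      - (2 * P.C₁ c) • (x - x'))
    (-((2 * P.C₀ c) • P.A (P.At (u - u') + c.σ • P.B c (x - x'))))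

theorem mkR_add (x₁ x₂ : E m) (y₁ y₂ : E q) (z₁ z₂ u₁ u₂ : E p) (x₁' x₂' : E m) (u₁' u₂' : E p) :
    mkR x₁ y₁ z₁ u₁ x₁' u₁' + mkR x₂ y₂ z₂ u₂ x₂' u₂'
      = mkR (x₁ + x₂) (y₁ + y₂) (z₁ + z₂) (u₁ + u₂) (x₁' + x₂') (u₁' + u₂') := rfl

theorem inner_mkR (x : E m) (y : E q) (z u : E p) (x' : E m) (u' : E p) (h : R m q p) :
    inner ℝ (mkR x y z u x' u') h = inner ℝ x h.fst + inner ℝ y h.snd.fst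
      + inner ℝ z h.snd.snd.fst + inner ℝ u h.snd.snd.snd.fst
      + inner ℝ x' h.snd.snd.snd.snd.fst + inner ℝ u' h.snd.snd.snd.snd.snd := by
  simp only [mkR, WithLp.prod_inner_apply]
  simp only [add_assoc]
  rfl

theorem norm_mkR_le (x : E m) (y : E q) (z u : E p) (x' : E m) (u' : E p) :
    ‖(mkR x y z u x' u' : R m q p)‖ ≤ ‖x‖ + ‖y‖ + ‖z‖ + ‖u‖ + ‖x'‖ + ‖u'‖ := by
  have key : ∀ {V W : Type} [NormedAddCommGroup V] [NormedAddCommGroup W] (a : V) (b : W),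
      ‖(WithLp.toLp 2 (a, b) : WithLp 2 (V × W))‖ ≤ ‖a‖ + ‖b‖ := by
    intro V W _ _ a b
    rw [WithLp.prod_norm_eq_of_L2]
    exact sqrt_sq_add_sq_le (norm_nonneg _) (norm_nonneg _)
  have h1 := key x (WithLp.toLp 2 (y, WithLp.toLp 2 (z, WithLp.toLp 2 (u, WithLp.toLp 2 (x', u')))))
  have h2 := key y (WithLp.toLp 2 (z, WithLp.toLp 2 (u, WithLp.toLp 2 (x', u'))))
  have h3 := key z (WithLp.toLp 2 (u, WithLp.toLp 2 (x', u')))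
  have h4 := key u (WithLp.toLp 2 (x', u'))
  have h5 := key x' u'
  rw [mkR]
  linarith

variable {P : Problem m q p} {c : Params} {x : ℕ → E m} {y : ℕ → E q} {z : ℕ → E p} {u : ℕ → E p}

theorem hasFDerivAt_smoothPart (hP : P.WellPosed) (X : R m q p) :
    HasFDerivAt (fun X : R m q p => P.H X.fst X.snd.fst
      + inner ℝ X.snd.snd.snd.fst (P.A X.fst - X.snd.snd.fst)
      + c.β / 2 * ‖P.A X.fst - X.snd.snd.fst‖ ^ 2
      + P.C₀ c * ‖P.At (X.snd.snd.snd.fst - X.snd.snd.snd.snd.snd)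
          + c.σ • P.B c (X.fst - X.snd.snd.snd.snd.fst)‖ ^ 2
      + P.C₁ c * ‖X.fst - X.snd.snd.snd.snd.fst‖ ^ 2)
      (innerSL ℝ (smoothGrad P c X.fst X.snd.fst X.snd.snd.fst X.snd.snd.snd.fst
        X.snd.snd.snd.snd.fst X.snd.snd.snd.snd.snd)) X := by
  set S1 := WithLp.sndL 2 ℝ (E m) (WithLp 2 (E q × WithLp 2 (E p × WithLp 2 (E p × WithLp 2 (E m × E p)))))
  set S2 := (WithLp.sndL 2 ℝ (E q) (WithLp 2 (E p × WithLp 2 (E p × WithLp 2 (E m × E p))))).comp S1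
  set S3 := (WithLp.sndL 2 ℝ (E p) (WithLp 2 (E p × WithLp 2 (E m × E p)))).comp S2
  set S4 := (WithLp.sndL 2 ℝ (E p) (WithLp 2 (E m × E p))).comp S3
  set px : R m q p →L[ℝ] E m := WithLp.fstL 2 ℝ _ _ with hpx
  set py : R m q p →L[ℝ] E q := (WithLp.fstL 2 ℝ _ _).comp S1 with hpy
  set pz : R m q p →L[ℝ] E p := (WithLp.fstL 2 ℝ _ _).comp S2 with hpz
  set pu : R m q p →L[ℝ] E p := (WithLp.fstL 2 ℝ _ _).comp S3 with hpu
  set px' : R m q p →L[ℝ] E m := (WithLp.fstL 2 ℝ _ _).comp S4 with hpx'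
  set pu' : R m q p →L[ℝ] E p := (WithLp.sndL 2 ℝ _ _).comp S4 with hpu'
  set l₁ : R m q p →L[ℝ] E p := P.A.comp px - pz with hl₁
  set l₂ : R m q p →L[ℝ] E m := P.At.comp (pu - pu') + c.σ • (P.B c).comp (px - px') with hl₂
  set l₃ : R m q p →L[ℝ] E m := px - px' with hl₃
  have hH : HasFDerivAt (fun X : R m q p => P.H (px X) (py X))
      ((fderiv ℝ (fun w : E m × E q => P.H w.1 w.2) (px X, py X)).comp (px.prod py)) X :=
    HasFDerivAt.comp (g := fun w : E m × E q => P.H w.1 w.2) (f := fun X => (px X, py X)) X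
      (hasFDerivAt_H hP _ _) (px.prod py).hasFDerivAt
  have h1 := (pu.hasFDerivAt (x := X)).inner ℝ (l₁.hasFDerivAt (x := X))
  have h2 := (l₁.hasFDerivAt (x := X)).norm_sq.const_mul (c.β / 2)
  have h3 := (l₂.hasFDerivAt (x := X)).norm_sq.const_mul (P.C₀ c)
  have h4 := (l₃.hasFDerivAt (x := X)).norm_sq.const_mul (P.C₁ c)
  refine ((((hH.add h1).add h2).add h3).add h4).congr_fderiv ?_
  refine ContinuousLinearMap.ext fun h => ?_
  have hAt : ∀ (a : E p) (b : E m), inner ℝ (P.At a) b = inner ℝ a (P.A b) := fun a b =>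
    ContinuousLinearMap.adjoint_inner_left _ _ _
  have hA : ∀ (a : E m) (b : E p), inner ℝ (P.A a) b = inner ℝ a (P.At b) := fun a b =>
    (ContinuousLinearMap.adjoint_inner_right _ _ _).symm
  -- Moving `A`, `Aᵀ` and `B` across the inner products regroups the six components of the gradient
  -- along the linear maps `l₁`, `l₂`, `l₃`, the form in which the chain rule delivers the
  -- derivative.
  have e : innerSL ℝ (smoothGrad P c (px X) (py X) (pz X) (pu X) (px' X) (pu' X)) h
      = (inner ℝ (P.gradX (px X) (py X)) (px h) + inner ℝ (P.gradY (px X) (py X)) (py h))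
        + (inner ℝ (pu X) (l₁ h) + inner ℝ (pu h) (l₁ X)) + c.β * inner ℝ (l₁ X) (l₁ h)
        + 2 * P.C₀ c * inner ℝ (l₂ X) (l₂ h) + 2 * P.C₁ c * inner ℝ (l₃ X) (l₃ h) := by
    rw [innerSL_apply_apply, smoothGrad, inner_mkR]
    change inner ℝ (P.gradX (px X) (py X) + P.At (pu X) + c.β • P.At (l₁ X)
        + (2 * P.C₀ c * c.σ) • ContinuousLinearMap.adjoint (P.B c) (l₂ X)
        + (2 * P.C₁ c) • (l₃ X)) (px h) + inner ℝ (P.gradY (px X) (py X)) (py h)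
      + inner ℝ (-(pu X) - c.β • (l₁ X)) (pz h)
      + inner ℝ (l₁ X + (2 * P.C₀ c) • P.A (l₂ X)) (pu h)
      + inner ℝ (-((2 * P.C₀ c * c.σ) • ContinuousLinearMap.adjoint (P.B c) (l₂ X))
        - (2 * P.C₁ c) • (l₃ X)) (px' h)
      + inner ℝ (-((2 * P.C₀ c) • P.A (l₂ X))) (pu' h) = _
    have f1 : l₁ h = P.A (px h) - pz h := rfl
    have f2 : l₂ h = P.At (pu h) - P.At (pu' h) + c.σ • (P.B c (px h) - P.B c (px' h)) := by
      rw [← map_sub, ← map_sub]; rfl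
    have f3 : l₃ h = px h - px' h := rfl
    rw [f1, f2, f3, real_inner_comm (l₁ X) (pu h)]
    simp only [inner_add_left, inner_sub_left, inner_neg_left, real_inner_smul_left,
      inner_add_right, inner_sub_right, real_inner_smul_right, hAt, hA,
      ContinuousLinearMap.adjoint_inner_left]
    ring
  refine Eq.trans ?_ e.symm
  rw [← fderiv_H_apply hP]
  simp
  ring

/-- The subgradient of `F` produced by the algorithm. -/
def subgradF (P : Problem m q p) (c : Params) (x : ℕ → E m) (z u : ℕ → E p) (n : ℕ) : E p :=
  u n + c.β • (P.A (x n) - z (n + 1))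

/-- The subgradient of `G` produced by the algorithm. -/
def subgradG (P : Problem m q p) (c : Params) (x : ℕ → E m) (y : ℕ → E q) (n : ℕ) : E q :=
  -P.gradY (x n) (y n) - c.μ • (y (n + 1) - y n)

/-- The subgradient of the regularized augmented Lagrangian produced by the algorithm. -/
def subgradPsi (P : Problem m q p) (c : Params) (x : ℕ → E m) (y : ℕ → E q) (z u : ℕ → E p)
    (n : ℕ) : R m q p :=
  smoothGrad P c (x (n + 1)) (y (n + 1)) (z (n + 1)) (u (n + 1)) (x n) (u n)
    + mkR 0 (subgradG P c x y n) (subgradF P c x z u n) 0 0 0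

theorem subgradF_mem (hP : P.WellPosed) (hgen : P.IsGenerated c x y z u) (n : ℕ) :
    subgradF P c x z u n ∈ frechetSubdiff P.F (z (n + 1)) := by
  refine mem_frechetSubdiff_of_minorant (hasFDerivAt_const_sub_penalty _ c.β _ _ _) ?_
    (minorant_of_mem_argmin hP.proper_F (hgen n).2.1)
  rw [add_sub_cancel_right, hP.proper_F.coe_toReal (F_iter_ne_top hP hgen n)]

theorem subgradG_mem (hP : P.WellPosed) (hgen : P.IsGenerated c x y z u) (n : ℕ) :
    subgradG P c x y n ∈ frechetSubdiff P.G (y (n + 1)) := by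
  refine mem_frechetSubdiff_of_minorant (hasFDerivAt_const_sub_linear_add_sq _ c.μ _ _ _) ?_
    (minorant_of_mem_argmin hP.proper_G (hgen n).1)
  rw [add_sub_cancel_right, hP.proper_G.coe_toReal (G_iter_ne_top hP hgen n)]

/-- The touching minorants of `F` and `G` plus the smooth part of `Ψ` form one differentiable
minorant touching `Ψ`, so no sum rule for subdifferentials is involved. -/
theorem subgradPsi_mem (hP : P.WellPosed) (hgen : P.IsGenerated c x y z u) (n : ℕ) :
    subgradPsi P c x y z u n ∈ frechetSubdiff (P.Psi c) (iter x y z u n) := by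
  have hS := hasFDerivAt_smoothPart (c := c) hP (iter x y z u n)
  have hF := HasFDerivAt.comp (f := fun X : R m q p => X.snd.snd.fst) (iter x y z u n)
    (hasFDerivAt_const_sub_penalty ((P.F (z (n + 1))).toReal + (inner ℝ (u n)
      (P.A (x n) - z (n + 1)) + c.β / 2 * ‖P.A (x n) - z (n + 1)‖ ^ 2)) c.β (u n) (P.A (x n))
      (z (n + 1)))
    ((WithLp.fstL 2 ℝ _ _).comp ((WithLp.sndL 2 ℝ _ _).comp (WithLp.sndL 2 ℝ _ _))).hasFDerivAt
  have hG := HasFDerivAt.comp (f := fun X : R m q p => X.snd.fst) (iter x y z u n)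
    (hasFDerivAt_const_sub_linear_add_sq ((P.G (y (n + 1))).toReal
      + (inner ℝ (P.gradY (x n) (y n)) (y (n + 1)) + c.μ / 2 * ‖y (n + 1) - y n‖ ^ 2))
      c.μ (P.gradY (x n) (y n)) (y n) (y (n + 1)))
    ((WithLp.fstL 2 ℝ _ _).comp (WithLp.sndL 2 ℝ _ _)).hasFDerivAt
  refine mem_frechetSubdiff_of_minorant (((hF.add hG).add hS).congr_fderiv ?_) ?_ ?_
  · refine ContinuousLinearMap.ext fun h => ?_
    change inner ℝ (subgradF P c x z u n) h.snd.snd.fst + inner ℝ (subgradG P c x y n) h.snd.fst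
      + inner ℝ (smoothGrad P c (x (n + 1)) (y (n + 1)) (z (n + 1)) (u (n + 1)) (x n) (u n)) h
      = inner ℝ (subgradPsi P c x y z u n) h
    rw [subgradPsi, inner_add_left, inner_mkR 0]
    simp only [inner_zero_left]
    ring
  · rw [Psi_iter hP hgen]
    norm_cast
    simp only [Pi.add_apply, Function.comp_apply]
    rw [psiSeq]
    change _ = (P.F (z (n + 1))).toReal + _ - (inner ℝ (u n)
      (P.A (x n) - z (n + 1)) + c.β / 2 * ‖P.A (x n) - z (n + 1)‖ ^ 2) +
      ((P.G (y (n + 1))).toReal + _ - (inner ℝ (P.gradY (x n) (y n)) (y (n + 1))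
        + c.μ / 2 * ‖y (n + 1) - y n‖ ^ 2)) + _
    rw [add_sub_cancel_right, add_sub_cancel_right]
    rfl
  · intro X
    rw [Pi.add_apply, Pi.add_apply, EReal.coe_add, EReal.coe_add]
    exact add_le_add (add_le_add (minorant_of_mem_argmin hP.proper_F (hgen n).2.1 X.snd.snd.fst)
      (minorant_of_mem_argmin hP.proper_G (hgen n).1 X.snd.fst)) le_rfl

end Subgradients

/-! ### Subgradient bound, lower bound and vanishing steps -/

section Estimates

variable {P : Problem m q p} {c : Params} {x : ℕ → E m} {y : ℕ → E q} {z : ℕ → E p} {u : ℕ → E p}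

theorem isBigO_mkR {l : Filter ℕ} {s : ℕ → ℝ} {x x' : ℕ → E m} {y : ℕ → E q} {z u u' : ℕ → E p}
    (hx : x =O[l] s) (hy : y =O[l] s) (hz : z =O[l] s) (hu : u =O[l] s) (hx' : x' =O[l] s)
    (hu' : u' =O[l] s) :
    (fun n => (mkR (x n) (y n) (z n) (u n) (x' n) (u' n) : R m q p)) =O[l] s := by
  refine IsBigO.trans (IsBigO.of_bound 1 (Eventually.of_forall fun n => ?_))
    (((((hx.norm_left.add hy.norm_left).add hz.norm_left).add hu.norm_left).add
      hx'.norm_left).add hu'.norm_left)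
  rw [one_mul]
  exact (norm_mkR_le _ _ _ _ _ _).trans (Real.le_norm_self _)

theorem isBigO_smul_left {V : Type*} [NormedAddCommGroup V] [NormedSpace ℝ V] {l : Filter ℕ}
    {s : ℕ → ℝ} {f : ℕ → V} (h : f =O[l] s) (k : ℝ) : (fun n => k • f n) =O[l] s :=
  h.const_smul_left k

theorem isBigO_clm {V W : Type*} [NormedAddCommGroup V] [NormedSpace ℝ V] [NormedAddCommGroup W]
    [NormedSpace ℝ W] {l : Filter ℕ} {s : ℕ → ℝ} {f : ℕ → V} (T : V →L[ℝ] W) (h : f =O[l] s) :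
    (fun n => T (f n)) =O[l] s :=
  (T.isBigO_comp f l).trans h

theorem isBigO_dx : (fun n => x (n + 1) - x n) =O[⊤] stepLen x y u :=
  IsBigO.of_bound 1 (Eventually.of_forall fun n => by
    rw [one_mul, Real.norm_of_nonneg (stepLen_nonneg n), stepLen, add_assoc]
    exact le_add_of_nonneg_right (by positivity))

theorem isBigO_dy : (fun n => y (n + 1) - y n) =O[⊤] stepLen x y u :=
  IsBigO.of_bound 1 (Eventually.of_forall fun n => by
    rw [one_mul, Real.norm_of_nonneg (stepLen_nonneg n), stepLen]
    linarith [norm_nonneg (x (n + 1) - x n), norm_nonneg (u (n + 1) - u n)])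

theorem isBigO_du : (fun n => u (n + 1) - u n) =O[⊤] stepLen x y u :=
  IsBigO.of_bound 1 (Eventually.of_forall fun n => by
    rw [one_mul, Real.norm_of_nonneg (stepLen_nonneg n), stepLen]
    exact le_add_of_nonneg_left (by positivity))

/-- The dual update read backwards: the dual increment measures infeasibility. For this reason
`stepLen` and `distTo` can leave out `z`. -/
theorem residual_eq (hgen : P.IsGenerated c x y z u) (hass : P.Assumptions c x y z u) (n : ℕ) :
    P.A (x (n + 1)) - z (n + 1) = (c.σ * c.β)⁻¹ • (u (n + 1) - u n) := by
  rw [u_step hgen, smul_smul, inv_mul_cancel₀ (mul_pos hass.σ_pos hass.β_pos).ne', one_smul]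

theorem isBigO_residual (hgen : P.IsGenerated c x y z u) (hass : P.Assumptions c x y z u) :
    (fun n => P.A (x (n + 1)) - z (n + 1)) =O[⊤] stepLen x y u := by
  simp only [residual_eq hgen hass]
  exact isBigO_smul_left isBigO_du _

/-- In each component the optimality condition of step `n` is subtracted from the same expression at
`n + 1`, so only increments of `x`, `y`, `u` remain. The filter `⊤` means one constant for all `n`.
-/
theorem isBigO_subgradPsi (hgen : P.IsGenerated c x y z u) (hass : P.Assumptions c x y z u) :
    (fun n => subgradPsi P c x y z u n) =O[⊤] stepLen x y u := by
  have hx : (fun n => x (n + 1) - x n) =O[⊤] stepLen x y u := isBigO_dx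
  have hy : (fun n => y (n + 1) - y n) =O[⊤] stepLen x y u := isBigO_dy
  have hu : (fun n => u (n + 1) - u n) =O[⊤] stepLen x y u := isBigO_du
  have hw : (fun n => P.At (u (n + 1) - u n) + c.σ • P.B c (x (n + 1) - x n))
      =O[⊤] stepLen x y u :=
    (isBigO_clm P.At hu).add (isBigO_smul_left (isBigO_clm (P.B c) hx) _)
  have hBw := isBigO_smul_left (isBigO_clm (ContinuousLinearMap.adjoint (P.B c)) hw)
    (2 * P.C₀ c * c.σ)
  have hAw := isBigO_smul_left (isBigO_clm P.A hw) (2 * P.C₀ c)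
  have hr := isBigO_residual hgen hass
  have hlip : (fun n => c.L * (‖x (n + 1) - x n‖ + ‖y (n + 1) - y n‖)) =O[⊤] stepLen x y u :=
    (hx.norm_left.add hy.norm_left).const_mul_left _
  have hgx : (fun n => P.gradX (x (n + 1)) (y (n + 1)) - P.gradX (x n) (y (n + 1)))
      =O[⊤] stepLen x y u :=
    (IsBigO.of_bound c.L (Eventually.of_forall fun n => by
      have := gradX_lipschitz hass (n + 1) n (n + 1) (n + 1)
      rwa [sub_self, norm_zero, add_zero] at this)).trans hx
  have hgy : (fun n => P.gradY (x (n + 1)) (y (n + 1)) - P.gradY (x n) (y n))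
      =O[⊤] stepLen x y u :=
    (IsBigO.of_bound 1 (Eventually.of_forall fun n => by
      rw [one_mul]
      exact (gradY_lipschitz hass (n + 1) n (n + 1) n).trans (Real.le_norm_self _))).trans hlip
  have hAx := isBigO_clm P.A hx
  have h1 : (fun n => P.gradX (x (n + 1)) (y (n + 1)) + P.At (u (n + 1))
      + c.β • P.At (P.A (x (n + 1)) - z (n + 1))) =O[⊤] stepLen x y u := by
    refine (((hgx.add (isBigO_clm P.At hu)).add (isBigO_smul_left (isBigO_clm P.At hAx) c.β)).sub
      (isBigO_smul_left hx c.τ)).congr_left fun n => ?_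
    rw [x_step hgen hass n]
    simp only [map_sub]
    module
  have h2 : (fun n => P.gradY (x (n + 1)) (y (n + 1)) + subgradG P c x y n)
      =O[⊤] stepLen x y u := by
    refine (hgy.sub (isBigO_smul_left hy c.μ)).congr_left fun n => ?_
    rw [subgradG]
    abel
  have h3 : (fun n => -u (n + 1) - c.β • (P.A (x (n + 1)) - z (n + 1)) + subgradF P c x z u n)
      =O[⊤] stepLen x y u := by
    refine (hu.neg_left.sub (isBigO_smul_left hAx c.β)).congr_left fun n => ?_
    rw [subgradF, map_sub]
    module
  simp only [subgradPsi, smoothGrad, mkR_add, add_zero]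
  exact isBigO_mkR ((h1.add hBw).add (isBigO_smul_left hx _)) h2 h3 (hr.add hAw)
    (hBw.neg_left.sub (isBigO_smul_left hx _)) hAw.neg_left

theorem exists_descent (hp : 0 < p) (hP : P.WellPosed) (hgen : P.IsGenerated c x y z u)
    (hass : P.Assumptions c x y z u) :
    ∃ a > 0, ∀ n, psiSeq P c x y z u (n + 1) + a * stepLen x y u (n + 1) ^ 2
      ≤ psiSeq P c x y z u n := by
  set k := min (P.C₂ c) (min (P.C₃ c) (Problem.C₄ c)) with hk
  have hk0 : 0 < k := hass.C_pos
  -- The `3` comes from `(a + b + c)² ≤ 3 (a² + b² + c²)`.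
  refine ⟨k / 3, by positivity, fun n => ?_⟩
  have h := psi_descent hp hP hgen hass n
  have h2 : k ≤ P.C₂ c := min_le_left _ _
  have h3 : k ≤ P.C₃ c := (min_le_right _ _).trans (min_le_left _ _)
  have h4 : k ≤ Problem.C₄ c := (min_le_right _ _).trans (min_le_right _ _)
  have e2 := mul_le_mul_of_nonneg_right h2 (sq_nonneg ‖x (n + 2) - x (n + 1)‖)
  have e3 := mul_le_mul_of_nonneg_right h3 (sq_nonneg ‖y (n + 2) - y (n + 1)‖)
  have e4 := mul_le_mul_of_nonneg_right h4 (sq_nonneg ‖u (n + 2) - u (n + 1)‖)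
  have e5 : stepLen x y u (n + 1) ^ 2 ≤ 3 * (‖x (n + 2) - x (n + 1)‖ ^ 2
      + ‖y (n + 2) - y (n + 1)‖ ^ 2 + ‖u (n + 2) - u (n + 1)‖ ^ 2) := by
    change (‖x (n + 2) - x (n + 1)‖ + ‖y (n + 2) - y (n + 1)‖ + ‖u (n + 2) - u (n + 1)‖) ^ 2 ≤ _
    nlinarith [sq_nonneg (‖x (n + 2) - x (n + 1)‖ - ‖y (n + 2) - y (n + 1)‖),
      sq_nonneg (‖y (n + 2) - y (n + 1)‖ - ‖u (n + 2) - u (n + 1)‖),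
      sq_nonneg (‖x (n + 2) - x (n + 1)‖ - ‖u (n + 2) - u (n + 1)‖)]
  have e6 := mul_le_mul_of_nonneg_left e5 (by positivity : 0 ≤ k / 3)
  linarith

theorem C₀_nonneg (hp : 0 < p) (hass : P.Assumptions c x y z u) : 0 ≤ P.C₀ c := by
  have := lam_pos (P := P) hp hass.surjective_A
  have := hass.β_pos
  have := sub_nonneg.2 hass.σ_le_one
  rw [Problem.C₀]
  positivity

theorem C₁_nonneg (hp : 0 < p) (hass : P.Assumptions c x y z u) : 0 ≤ P.C₁ c := by
  have := lam_pos (P := P) hp hass.surjective_A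
  have := hass.β_pos
  have := hass.σ_pos
  rw [Problem.C₁]
  positivity

/-- The pairing `⟨u, Ax - z⟩` is the only term neither nonnegative nor bounded below by assumption;
boundedness of the sequence controls it. -/
theorem psiSeq_bddBelow (hp : 0 < p) (hP : P.WellPosed) (hgen : P.IsGenerated c x y z u)
    (hass : P.Assumptions c x y z u) : ∃ b, ∀ n, b ≤ psiSeq P c x y z u n := by
  obtain ⟨bF, hF⟩ := hass.bddBelow_F
  obtain ⟨bG, hG⟩ := hass.bddBelow_G
  obtain ⟨bH, hH⟩ := hass.bddBelow_H
  obtain ⟨M, hM⟩ := hass.bounded_seq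
  have hC₀ := C₀_nonneg hp hass
  have hC₁ := C₁_nonneg hp hass
  have hβ := hass.β_pos
  refine ⟨bF + bG + (bH - M * (‖P.A‖ * M + M)), fun n => ?_⟩
  have h1 : bF ≤ (P.F (z (n + 1))).toReal := by
    have := hF (z (n + 1))
    rw [← hP.proper_F.coe_toReal (F_iter_ne_top hP hgen n)] at this
    exact_mod_cast this
  have h2 : bG ≤ (P.G (y (n + 1))).toReal := by
    have := hG (y (n + 1))
    rw [← hP.proper_G.coe_toReal (G_iter_ne_top hP hgen n)] at this
    exact_mod_cast this
  obtain ⟨hx, -, hz, hu⟩ := hM (n + 1)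
  have hM0 : 0 ≤ M := (norm_nonneg _).trans hx
  have h3 : -(M * (‖P.A‖ * M + M))
      ≤ inner ℝ (u (n + 1)) (P.A (x (n + 1)) - z (n + 1)) := by
    have e1 := neg_le_of_abs_le (abs_real_inner_le_norm (u (n + 1))
      (P.A (x (n + 1)) - z (n + 1)))
    refine le_trans (neg_le_neg ?_) e1
    refine mul_le_mul hu ((norm_sub_le _ _).trans (add_le_add ?_ hz)) (norm_nonneg _) hM0
    exact (P.A.le_opNorm _).trans (mul_le_mul_of_nonneg_left hx (norm_nonneg _))
  have h4 : 0 ≤ c.β / 2 * ‖P.A (x (n + 1)) - z (n + 1)‖ ^ 2 := by positivity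
  have h5 : 0 ≤ P.C₀ c * ‖P.At (u (n + 1) - u n) + c.σ • P.B c (x (n + 1) - x n)‖ ^ 2 := by
    positivity
  have h6 : 0 ≤ P.C₁ c * ‖x (n + 1) - x n‖ ^ 2 := by positivity
  have h7 := hH (x (n + 1)) (y (n + 1))
  rw [psiSeq]
  linarith

theorem exists_tendsto_psiSeq (hp : 0 < p) (hP : P.WellPosed) (hgen : P.IsGenerated c x y z u)
    (hass : P.Assumptions c x y z u) :
    ∃ l, Tendsto (psiSeq P c x y z u) atTop (𝓝 l) ∧ ∀ n, l ≤ psiSeq P c x y z u n := by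
  obtain ⟨a, ha, hd⟩ := exists_descent hp hP hgen hass
  obtain ⟨b, hb⟩ := psiSeq_bddBelow hp hP hgen hass
  have hanti : Antitone (psiSeq P c x y z u) := antitone_nat_of_succ_le fun n =>
    (le_add_of_nonneg_right (by positivity)).trans (hd n)
  have hbdd : BddBelow (Set.range (psiSeq P c x y z u)) := ⟨b, by rintro _ ⟨n, rfl⟩; exact hb n⟩
  exact ⟨_, tendsto_atTop_ciInf hanti hbdd, fun n => ciInf_le hbdd n⟩

theorem tendsto_stepLen (hp : 0 < p) (hP : P.WellPosed) (hgen : P.IsGenerated c x y z u)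
    (hass : P.Assumptions c x y z u) : Tendsto (stepLen x y u) atTop (𝓝 0) := by
  obtain ⟨a, ha, hd⟩ := exists_descent hp hP hgen hass
  obtain ⟨l, hl, -⟩ := exists_tendsto_psiSeq hp hP hgen hass
  exact tendsto_zero_of_sq_descent ha (fun n => stepLen_nonneg n) hd hl

end Estimates

/-! ### Cluster points are KKT points and critical points -/

section Cluster

variable {P : Problem m q p} {c : Params} {x : ℕ → E m} {y : ℕ → E q} {z : ℕ → E p} {u : ℕ → E p}
  {φ : ℕ → ℕ} {xs : E m} {ys : E q} {zs us : E p}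

theorem tendsto_comp_of_isBigO {V : Type*} [NormedAddCommGroup V] {f : ℕ → V} {s : ℕ → ℝ}
    (h : f =O[⊤] s) (hs : Tendsto s atTop (𝓝 0)) (hφ : Tendsto φ atTop atTop) :
    Tendsto (fun k => f (φ k)) atTop (𝓝 0) :=
  ((h.mono le_top).trans_tendsto hs).comp hφ

theorem tendsto_gradX (hP : P.WellPosed) {a : ℕ → E m} {b : ℕ → E q}
    (ha : Tendsto a atTop (𝓝 xs)) (hb : Tendsto b atTop (𝓝 ys)) :
    Tendsto (fun k => P.gradX (a k) (b k)) atTop (𝓝 (P.gradX xs ys)) := by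
  have h := ((continuous_gradX hP).tendsto (xs, ys)).comp (ha.prodMk_nhds hb)
  simp only [Function.comp_def] at h
  exact h

theorem tendsto_gradY (hP : P.WellPosed) {a : ℕ → E m} {b : ℕ → E q}
    (ha : Tendsto a atTop (𝓝 xs)) (hb : Tendsto b atTop (𝓝 ys)) :
    Tendsto (fun k => P.gradY (a k) (b k)) atTop (𝓝 (P.gradY xs ys)) := by
  have h := ((continuous_gradY hP).tendsto (xs, ys)).comp (ha.prodMk_nhds hb)
  simp only [Function.comp_def] at h
  exact h

theorem tendsto_H (hP : P.WellPosed) {a : ℕ → E m} {b : ℕ → E q}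
    (ha : Tendsto a atTop (𝓝 xs)) (hb : Tendsto b atTop (𝓝 ys)) :
    Tendsto (fun k => P.H (a k) (b k)) atTop (𝓝 (P.H xs ys)) :=
  Tendsto.comp (g := fun w : E m × E q => P.H w.1 w.2)
    (hP.smooth_H.continuous.tendsto (xs, ys)) (ha.prodMk_nhds hb)

theorem tendsto_clm {V W : Type*} [NormedAddCommGroup V] [NormedSpace ℝ V] [NormedAddCommGroup W]
    [NormedSpace ℝ W] (T : V →L[ℝ] W) {f : ℕ → V} {v : V} (h : Tendsto f atTop (𝓝 v)) :
    Tendsto (fun k => T (f k)) atTop (𝓝 (T v)) :=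
  (T.continuous.tendsto v).comp h

theorem tendsto_mkR {a a' : ℕ → E m} {b : ℕ → E q} {e d d' : ℕ → E p} {xs' : E m} {us' : E p}
    (ha : Tendsto a atTop (𝓝 xs)) (hb : Tendsto b atTop (𝓝 ys)) (he : Tendsto e atTop (𝓝 zs))
    (hd : Tendsto d atTop (𝓝 us)) (ha' : Tendsto a' atTop (𝓝 xs'))
    (hd' : Tendsto d' atTop (𝓝 us')) :
    Tendsto (fun k => mkR (a k) (b k) (e k) (d k) (a' k) (d' k)) atTop
      (𝓝 (mkR xs ys zs us xs' us')) := by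
  rw [tendsto_iff_norm_sub_tendsto_zero] at *
  have hsum := ((((ha.add hb).add he).add hd).add ha').add hd'
  simp only [add_zero] at hsum
  exact squeeze_zero (fun _ => norm_nonneg _) (fun k => norm_mkR_le (a k - xs) (b k - ys) (e k - zs)
    (d k - us) (a' k - xs') (d' k - us')) hsum

theorem tendsto_G (hP : P.WellPosed) (hgen : P.IsGenerated c x y z u)
    (hx : Tendsto (fun k => x (φ k)) atTop (𝓝 xs)) (hy : Tendsto (fun k => y (φ k)) atTop (𝓝 ys))
    (hy1 : Tendsto (fun k => y (φ k + 1)) atTop (𝓝 ys)) :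
    P.G ys ≠ ⊤ ∧ Tendsto (fun k => (P.G (y (φ k + 1))).toReal) atTop (𝓝 (P.G ys).toReal) := by
  have hgY := tendsto_gradY hP hx hy
  exact tendsto_toReal_of_mem_argmin hP.proper_G hP.lsc_G hy1
    (fun k => (hgen (φ k)).1) (ρ := fun b => inner ℝ (P.gradY xs ys) b + c.μ / 2 * ‖b - ys‖ ^ 2)
    (fun b => (hgY.inner tendsto_const_nhds).add
      (((tendsto_const_nhds.sub hy).norm.pow 2).const_mul _))
    ((hgY.inner hy1).add (((hy1.sub hy).norm.pow 2).const_mul _))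

theorem tendsto_F (hP : P.WellPosed) (hgen : P.IsGenerated c x y z u)
    (hx : Tendsto (fun k => x (φ k)) atTop (𝓝 xs)) (hu : Tendsto (fun k => u (φ k)) atTop (𝓝 us))
    (hz1 : Tendsto (fun k => z (φ k + 1)) atTop (𝓝 zs)) :
    P.F zs ≠ ⊤ ∧ Tendsto (fun k => (P.F (z (φ k + 1))).toReal) atTop (𝓝 (P.F zs).toReal) := by
  have hAx := tendsto_clm P.A hx
  exact tendsto_toReal_of_mem_argmin hP.proper_F hP.lsc_F hz1
    (fun k => (hgen (φ k)).2.1)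
    (ρ := fun b => inner ℝ us (P.A xs - b) + c.β / 2 * ‖P.A xs - b‖ ^ 2)
    (fun b => (hu.inner (hAx.sub tendsto_const_nhds)).add
      (((hAx.sub tendsto_const_nhds).norm.pow 2).const_mul _))
    ((hu.inner (hAx.sub hz1)).add (((hAx.sub hz1).norm.pow 2).const_mul _))

theorem mem_limitingSubdiff_G (hP : P.WellPosed) (hgen : P.IsGenerated c x y z u)
    (hx : Tendsto (fun k => x (φ k)) atTop (𝓝 xs)) (hy : Tendsto (fun k => y (φ k)) atTop (𝓝 ys))
    (hy1 : Tendsto (fun k => y (φ k + 1)) atTop (𝓝 ys)) :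
    -P.gradY xs ys ∈ limitingSubdiff P.G ys := by
  obtain ⟨htop, hlim⟩ := tendsto_G hP hgen hx hy hy1
  have hlim' : Tendsto (fun k => P.G (y (φ k + 1))) atTop (𝓝 (P.G ys)) := by
    rw [← hP.proper_G.coe_toReal htop]
    exact (((continuous_coe_real_ereal.tendsto _).comp hlim)).congr fun k =>
      hP.proper_G.coe_toReal (G_iter_ne_top hP hgen _)
  refine mem_limitingSubdiff_of_tendsto (lt_top_iff_ne_top.2 htop) hy1 ?_ hlim'
    (fun k => subgradG_mem hP hgen (φ k))
  simpa [subgradG] using (tendsto_gradY hP hx hy).neg.sub ((hy1.sub hy).const_smul c.μ)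

theorem mem_limitingSubdiff_F (hP : P.WellPosed) (hgen : P.IsGenerated c x y z u)
    (hx : Tendsto (fun k => x (φ k)) atTop (𝓝 xs)) (hu : Tendsto (fun k => u (φ k)) atTop (𝓝 us))
    (hz1 : Tendsto (fun k => z (φ k + 1)) atTop (𝓝 (P.A xs))) :
    us ∈ limitingSubdiff P.F (P.A xs) := by
  obtain ⟨htop, hlim⟩ := tendsto_F hP hgen hx hu hz1
  have hlim' : Tendsto (fun k => P.F (z (φ k + 1))) atTop (𝓝 (P.F (P.A xs))) := by
    rw [← hP.proper_F.coe_toReal htop]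
    exact (((continuous_coe_real_ereal.tendsto _).comp hlim)).congr fun k =>
      hP.proper_F.coe_toReal (F_iter_ne_top hP hgen _)
  refine mem_limitingSubdiff_of_tendsto (lt_top_iff_ne_top.2 htop) hz1 ?_ hlim'
    (fun k => subgradF_mem hP hgen (φ k))
  simpa [subgradF] using hu.add (((tendsto_clm P.A hx).sub hz1).const_smul c.β)

theorem Psi_limit (hP : P.WellPosed) (hF : P.F (P.A xs) ≠ ⊤) (hG : P.G ys ≠ ⊤) :
    P.Psi c (mkR xs ys (P.A xs) us xs us)
      = (((P.F (P.A xs)).toReal + (P.G ys).toReal + P.H xs ys : ℝ) : EReal) := by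
  have : P.Psi c (mkR xs ys (P.A xs) us xs us) = P.PsiFun c xs ys (P.A xs) us xs us := rfl
  rw [this, Problem.PsiFun]
  conv_lhs => rw [← hP.proper_F.coe_toReal hF, ← hP.proper_G.coe_toReal hG]
  simp

theorem tendsto_psiSeq_comp {Fs Gs : ℝ} (hP : P.WellPosed)
    (hdx : Tendsto (fun k => x (φ k + 1) - x (φ k)) atTop (𝓝 0))
    (hdu : Tendsto (fun k => u (φ k + 1) - u (φ k)) atTop (𝓝 0))
    (hr : Tendsto (fun k => P.A (x (φ k + 1)) - z (φ k + 1)) atTop (𝓝 0))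
    (hx1 : Tendsto (fun k => x (φ k + 1)) atTop (𝓝 xs))
    (hy1 : Tendsto (fun k => y (φ k + 1)) atTop (𝓝 ys))
    (hu1 : Tendsto (fun k => u (φ k + 1)) atTop (𝓝 us))
    (hFlim : Tendsto (fun k => (P.F (z (φ k + 1))).toReal) atTop (𝓝 Fs))
    (hGlim : Tendsto (fun k => (P.G (y (φ k + 1))).toReal) atTop (𝓝 Gs)) :
    Tendsto (fun k => psiSeq P c x y z u (φ k)) atTop (𝓝 (Fs + Gs + P.H xs ys)) := by
  have hH := tendsto_H hP hx1 hy1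
  have hw := (tendsto_clm P.At hdu).add ((tendsto_clm (P.B c) hdx).const_smul c.σ)
  have h := (hFlim.add hGlim).add ((((hH.add (hu1.inner hr)).add
    ((hr.norm.pow 2).const_mul (c.β / 2))).add ((hw.norm.pow 2).const_mul (P.C₀ c))).add
    ((hdx.norm.pow 2).const_mul (P.C₁ c)))
  have e : Fs + Gs + (P.H xs ys + inner ℝ us (0 : E p) + c.β / 2 * ‖(0 : E p)‖ ^ 2
      + P.C₀ c * ‖P.At 0 + c.σ • P.B c 0‖ ^ 2 + P.C₁ c * ‖(0 : E m)‖ ^ 2)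
      = Fs + Gs + P.H xs ys := by simp
  rw [e] at h
  exact h

/-- Cluster points of the iterates are KKT points and critical points of `Ψ`, with the limiting
value. -/
theorem cluster_point (hp : 0 < p) (hP : P.WellPosed) (hgen : P.IsGenerated c x y z u)
    (hass : P.Assumptions c x y z u) (hφt : Tendsto φ atTop atTop)
    (hx : Tendsto (fun k => x (φ k)) atTop (𝓝 xs))
    (hy : Tendsto (fun k => y (φ k)) atTop (𝓝 ys))
    (hu : Tendsto (fun k => u (φ k)) atTop (𝓝 us)) {l : ℝ}
    (hl : Tendsto (psiSeq P c x y z u) atTop (𝓝 l)) :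
    P.IsKKT xs ys (P.A xs) us ∧ P.Psi c (mkR xs ys (P.A xs) us xs us) = l ∧
      mkR xs ys (P.A xs) us xs us ∈ crit (P.Psi c) := by
  have hs := tendsto_stepLen hp hP hgen hass
  have hdx := tendsto_comp_of_isBigO (isBigO_dx (x := x) (y := y) (u := u)) hs hφt
  have hdy := tendsto_comp_of_isBigO (isBigO_dy (x := x) (y := y) (u := u)) hs hφt
  have hdu := tendsto_comp_of_isBigO (isBigO_du (x := x) (y := y) (u := u)) hs hφt
  have hr := tendsto_comp_of_isBigO (isBigO_residual hgen hass) hs hφt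
  have hx1 : Tendsto (fun k => x (φ k + 1)) atTop (𝓝 xs) := by
    simpa only [sub_add_cancel, zero_add] using hdx.add hx
  have hy1 : Tendsto (fun k => y (φ k + 1)) atTop (𝓝 ys) := by
    simpa only [sub_add_cancel, zero_add] using hdy.add hy
  have hu1 : Tendsto (fun k => u (φ k + 1)) atTop (𝓝 us) := by
    simpa only [sub_add_cancel, zero_add] using hdu.add hu
  have hz1 : Tendsto (fun k => z (φ k + 1)) atTop (𝓝 (P.A xs)) := by
    simpa only [sub_sub_cancel, sub_zero] using (tendsto_clm P.A hx1).sub hr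
  obtain ⟨hGtop, hGlim⟩ := tendsto_G hP hgen hx hy hy1
  obtain ⟨hFtop, hFlim⟩ := tendsto_F hP hgen hx hu hz1
  have hψlim := tendsto_psiSeq_comp (c := c) hP hdx hdu hr hx1 hy1 hu1 hFlim hGlim
  -- The whole sequence of values tends to `l`, so the value of `Ψ` at this cluster point must be
  -- `l`.
  have hleq := tendsto_nhds_unique hψlim (hl.comp hφt)
  have hψ : P.Psi c (mkR xs ys (P.A xs) us xs us) = l := by rw [Psi_limit hP hFtop hGtop, hleq]
  refine ⟨⟨?_, ⟨-P.gradY xs ys, mem_limitingSubdiff_G hP hgen hx hy hy1, neg_add_cancel _⟩,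
    mem_limitingSubdiff_F hP hgen hx hu hz1, rfl⟩, hψ, ?_⟩
  -- Stationarity in `x` is the limit of `x_step`: the increment of `x` and `A x - z` both vanish.
  · have h1 := (((hdx.const_smul c.τ).neg).sub (tendsto_clm P.At hu)).sub
      ((tendsto_clm P.At ((tendsto_clm P.A hx).sub hz1)).const_smul c.β)
    have h2 := tendsto_nhds_unique (h1.congr fun k => (x_step hgen hass (φ k)).symm)
      (tendsto_gradX hP hx hy1)
    rw [← h2]
    simp
  · refine mem_limitingSubdiff_of_tendsto (vs := fun k => iter x y z u (φ k)) (by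
      rw [hψ]; exact EReal.coe_lt_top _) (tendsto_mkR hx1 hy1 hz1 hu1 hx hu)
      (tendsto_comp_of_isBigO (isBigO_subgradPsi hgen hass) hs hφt) ?_
      (fun k => subgradPsi_mem hP hgen (φ k))
    rw [hψ]
    exact (((continuous_coe_real_ereal.tendsto _).comp (hl.comp hφt))).congr fun k =>
      (Psi_iter hP hgen _).symm

/-- Compactness is needed only for `(x, y, u)`; the limit of `z` is then forced to be `A xs`. -/
theorem exists_cluster_point (hass : P.Assumptions c x y z u) :
    ∃ (φ : ℕ → ℕ) (xs : E m) (ys : E q) (us : E p), Tendsto φ atTop atTop ∧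
      Tendsto (fun k => x (φ k)) atTop (𝓝 xs) ∧ Tendsto (fun k => y (φ k)) atTop (𝓝 ys) ∧
      Tendsto (fun k => u (φ k)) atTop (𝓝 us) := by
  obtain ⟨M, hM⟩ := hass.bounded_seq
  obtain ⟨w, -, φ, hφ, hw⟩ := ((isCompact_closedBall (0 : E m) M).prod
    ((isCompact_closedBall (0 : E q) M).prod (isCompact_closedBall (0 : E p) M))).tendsto_subseq
    (x := fun n => (x n, y n, u n)) (fun n => by
      obtain ⟨h1, h2, -, h4⟩ := hM n
      simp [h1, h2, h4])
  exact ⟨φ, w.1, w.2.1, w.2.2, hφ.tendsto_atTop, (continuous_fst.tendsto w).comp hw,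
    ((continuous_fst.comp continuous_snd).tendsto w).comp hw,
    ((continuous_snd.comp continuous_snd).tendsto w).comp hw⟩

end Cluster

/-! ### From decay of the gap to convergence rates -/

section Rates

variable {a C K θ : ℝ} {e s d : ℕ → ℝ}

/-- Decrease gives `s_{n+1} ≤ √(e_n / a)`, so the distance is of order `e_n^(1/2) + e_n^(1-θ)`. As
`e_n ≤ 1`, any exponent `r` below both dominates: `1/2` in the linear regime, `1 - θ` in the
sublinear one. -/
theorem dist_add_step_le {r : ℝ} (ha : 0 < a) (hK : 0 ≤ K) (hr0 : 0 ≤ r) (hr : r ≤ 1 / 2)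
    (hrθ : r ≤ 1 - θ) (he : ∀ n, 0 ≤ e n)
    (hdesc : ∀ n, e (n + 1) + a * s (n + 1) ^ 2 ≤ e n) {n : ℕ} (hn : e n ≤ 1)
    (hd : d (n + 1) ≤ s (n + 1) + K * e (n + 1) ^ (1 - θ)) :
    d (n + 1) + s (n + 1) ≤ (2 / √a + K) * e n ^ r := by
  have h1 : s (n + 1) ≤ e n ^ r / √a := by
    have e1 : s (n + 1) ≤ √(e n / a) := by
      apply Real.le_sqrt_of_sq_le
      rw [le_div_iff₀ ha]
      linarith [hdesc n, he (n + 1)]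
    rw [Real.sqrt_div (he n)] at e1
    refine e1.trans ?_
    gcongr
    rw [Real.sqrt_eq_rpow]
    exact Real.rpow_le_rpow_of_exponent_ge' (he n) hn hr0 hr
  have h2 : e (n + 1) ^ (1 - θ) ≤ e n ^ r :=
    calc e (n + 1) ^ (1 - θ) ≤ e n ^ (1 - θ) :=
          Real.rpow_le_rpow (he _) (by nlinarith [hdesc n, sq_nonneg (s (n + 1))])
            (hr0.trans hrθ)
      _ ≤ e n ^ r := Real.rpow_le_rpow_of_exponent_ge' (he n) hn hr0 hrθ
  calc d (n + 1) + s (n + 1) ≤ 2 * s (n + 1) + K * e (n + 1) ^ (1 - θ) := by linarith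
    _ ≤ 2 * (e n ^ r / √a) + K * e n ^ r := by gcongr
    _ = (2 / √a + K) * e n ^ r := by ring

theorem finite_convergence (ha : 0 < a) (hC : 0 < C) (he : ∀ n, 0 ≤ e n)
    (hd : ∀ n, 0 ≤ d n) (hdesc : ∀ n, e (n + 1) + a * s (n + 1) ^ 2 ≤ e n)
    (hlim : Tendsto e atTop (𝓝 0)) {N : ℕ}
    (hN : ∀ n ≥ N, (e n ≠ 0 → e n ^ (0 : ℝ) ≤ C * s n) ∧ d n ≤ s n + K * e n ^ (1 - (0 : ℝ))) :
    ∃ N, ∀ n ≥ N, d n + s n = 0 := by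
  obtain ⟨N₁, hN₁⟩ := exists_gap_eq_zero ha hC he hdesc hlim fun n hn => (hN n hn).1
  refine ⟨max N N₁ + 1, fun n hn => ?_⟩
  obtain ⟨k, rfl⟩ : ∃ k, n = k + 1 := ⟨n - 1, by omega⟩
  have h1 := hdesc k
  rw [hN₁ k (by omega), hN₁ (k + 1) (by omega), zero_add] at h1
  have h2 : s (k + 1) = 0 := by
    have : a * s (k + 1) ^ 2 = 0 := le_antisymm h1 (by positivity)
    simpa [ha.ne'] using this
  have h3 := (hN (k + 1) (by omega)).2
  rw [hN₁ (k + 1) (by omega), h2, sub_zero, Real.rpow_one, mul_zero, add_zero] at h3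
  rw [h2, le_antisymm h3 (hd _), add_zero]

theorem linear_convergence (ha : 0 < a) (hC : 0 < C) (hK : 0 ≤ K) (hθ : θ ≤ 1 / 2)
    (he : ∀ n, 0 ≤ e n) (hdesc : ∀ n, e (n + 1) + a * s (n + 1) ^ 2 ≤ e n)
    (hlim : Tendsto e atTop (𝓝 0)) {N : ℕ}
    (hN : ∀ n ≥ N, (e n ≠ 0 → e n ^ θ ≤ C * s n) ∧ d n ≤ s n + K * e n ^ (1 - θ)) :
    ∃ N M Q, 0 < M ∧ 0 < Q ∧ Q < 1 ∧ ∀ n ≥ N, d n + s n ≤ M * Q ^ (n + 1) := by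
  obtain ⟨N₁, hN₁⟩ := eventually_atTop.1 (hlim.eventually_le_const zero_lt_one)
  set N₂ := max N N₁ with hN₂
  obtain ⟨Q, hQ0, hQ1, hQ⟩ := exists_gap_geometric (N := N₂) ha hC hθ he hdesc
    (fun n hn => hN₁ n ((le_max_right _ _).trans hn))
    (fun n hn => (hN n ((le_max_left _ _).trans hn)).1)
  have hsa : 0 < √a := Real.sqrt_pos.2 ha
  have hsQ : 0 < √Q := Real.sqrt_pos.2 hQ0
  -- The distance is of the order of the square root of the gap, hence the rate `√Q`. The power `n +
  -- 1` appears because `d n` measures iterate `n + 1`, and `√Q ^ (N₂ + 2)` undoes the shift `n + 1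
  -- = (N₂ + 2) + k`.
  refine ⟨N₂ + 1, (2 / √a + K) / √Q ^ (N₂ + 2), √Q, by positivity, hsQ, ?_, fun n hn => ?_⟩
  · rw [Real.sqrt_lt' zero_lt_one]; simpa using hQ1
  obtain ⟨k, rfl⟩ : ∃ k, n = N₂ + k + 1 := ⟨n - N₂ - 1, by omega⟩
  have h1 := dist_add_step_le (r := 1 / 2) (θ := θ) ha hK (by norm_num) le_rfl (by linarith) he
    hdesc (n := N₂ + k) (hN₁ _ (by omega)) (hN (N₂ + k + 1) (by omega)).2
  refine h1.trans ?_
  have h2 : e (N₂ + k) ^ (1 / 2 : ℝ) ≤ √Q ^ k := by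
    rw [← Real.sqrt_eq_rpow]
    apply Real.sqrt_le_iff.2 ⟨by positivity, ?_⟩
    rw [← pow_mul, mul_comm, pow_mul, Real.sq_sqrt hQ0.le]
    exact hQ k
  calc (2 / √a + K) * e (N₂ + k) ^ (1 / 2 : ℝ) ≤ (2 / √a + K) * √Q ^ k := by gcongr
    _ = (2 / √a + K) / √Q ^ (N₂ + 2) * √Q ^ (N₂ + k + 1 + 1) := by
      rw [show N₂ + k + 1 + 1 = (N₂ + 2) + k by ring, pow_add _ (N₂ + 2) k, div_mul_eq_mul_div,
        mul_left_comm, mul_div_cancel_left₀ _ (pow_pos hsQ _).ne']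

theorem sublinear_convergence (ha : 0 < a) (hC : 0 < C) (hK : 0 ≤ K) (hθ : 1 / 2 < θ)
    (hθ1 : θ < 1) (he : ∀ n, 0 ≤ e n) (hdesc : ∀ n, e (n + 1) + a * s (n + 1) ^ 2 ≤ e n)
    (hlim : Tendsto e atTop (𝓝 0)) {N : ℕ}
    (hN : ∀ n ≥ N, (e n ≠ 0 → e n ^ θ ≤ C * s n) ∧ d n ≤ s n + K * e n ^ (1 - θ)) :
    ∃ N M, 0 < M ∧ ∀ n ≥ N, d n + s n ≤ M * ((n : ℝ) + 1) ^ (-((1 - θ) / (2 * θ - 1))) := by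
  obtain ⟨N₁, hN₁⟩ := eventually_atTop.1 (hlim.eventually_le_const zero_lt_one)
  set N₂ := max N N₁ with hN₂
  obtain ⟨M, hM, hbound⟩ := exists_gap_power (e := fun n => e (N₂ + n)) (r := 2 * θ - 1)
    (b := a / C ^ 2) (by linarith) (by linarith) (by positivity) (fun n => he _) (fun n hne => by
      have := gap_rpow_le ha hC he hdesc (hN (N₂ + n + 1) (by omega)).1 hne
      rwa [add_sub_cancel])
  have hγ : 0 < (1 - θ) / (2 * θ - 1) := div_pos (by linarith) (by linarith)
  set γ := (1 - θ) / (2 * θ - 1) with hγdef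
  have hsa : 0 < √a := Real.sqrt_pos.2 ha
  have hN₂0 : (0 : ℝ) ≤ N₂ := Nat.cast_nonneg _
  -- The factor `(N₂ + 2)^γ` undoes the index shift, through `N₂ + k + 2 ≤ (N₂ + 2)(k + 1)`.
  refine ⟨N₂ + 1, (2 / √a + K) * M ^ (1 - θ) * ((N₂ : ℝ) + 2) ^ γ, by positivity, fun n hn => ?_⟩
  obtain ⟨k, rfl⟩ : ∃ k, n = N₂ + k + 1 := ⟨n - N₂ - 1, by omega⟩
  have h1 := dist_add_step_le (r := 1 - θ) (θ := θ) ha hK (by linarith) (by linarith) le_rfl he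
    hdesc (n := N₂ + k) (hN₁ _ (by omega)) (hN (N₂ + k + 1) (by omega)).2
  refine h1.trans ?_
  have hk : (0 : ℝ) ≤ k := Nat.cast_nonneg _
  have h2 : e (N₂ + k) ^ (1 - θ) ≤ M ^ (1 - θ) * ((k : ℝ) + 1) ^ (-γ) := by
    calc e (N₂ + k) ^ (1 - θ) ≤ (M * ((k : ℝ) + 1) ^ (-(1 / (2 * θ - 1)))) ^ (1 - θ) :=
          Real.rpow_le_rpow (he _) (hbound k) (by linarith)
      _ = M ^ (1 - θ) * ((k : ℝ) + 1) ^ (-γ) := by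
          rw [Real.mul_rpow hM.le (by positivity), ← Real.rpow_mul (by positivity), hγdef]
          congr 2
          ring
  have h3 : ((k : ℝ) + 1) ^ (-γ) ≤ ((N₂ : ℝ) + 2) ^ γ * (((N₂ + k + 1 : ℕ) : ℝ) + 1) ^ (-γ) := by
    push_cast
    have hpos : (0 : ℝ) < N₂ + k + 1 + 1 := by positivity
    rw [Real.rpow_neg (by positivity), Real.rpow_neg hpos.le, ← div_eq_mul_inv,
      ← Real.div_rpow (by positivity) hpos.le, ← Real.inv_rpow (by positivity)]
    refine Real.rpow_le_rpow (by positivity) ?_ hγ.le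
    rw [← one_div, div_le_div_iff₀ (by positivity) hpos]
    nlinarith
  calc (2 / √a + K) * e (N₂ + k) ^ (1 - θ)
      ≤ (2 / √a + K) * (M ^ (1 - θ) * (((N₂ : ℝ) + 2) ^ γ
        * (((N₂ + k + 1 : ℕ) : ℝ) + 1) ^ (-γ))) := by
        gcongr
        exact h2.trans (by gcongr)
    _ = _ := by ring

end Rates

/-! ### The Łojasiewicz inequality along the iterates -/

section Convergence

variable {P : Problem m q p} {c : Params} {x : ℕ → E m} {y : ℕ → E q} {z : ℕ → E p} {u : ℕ → E p}
  {xs : E m} {ys : E q} {us : E p}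

/-- The distance of the `(n + 1)`-st iterate to a point in the variables `x`, `y`, `u`. -/
def distTo (x : ℕ → E m) (y : ℕ → E q) (u : ℕ → E p) (xs : E m) (ys : E q) (us : E p)
    (n : ℕ) : ℝ :=
  ‖x (n + 1) - xs‖ + ‖y (n + 1) - ys‖ + ‖u (n + 1) - us‖

theorem distTo_nonneg (n : ℕ) : 0 ≤ distTo x y u xs ys us n := by
  unfold distTo; positivity

theorem abs_distTo_sub_le (n : ℕ) :
    |distTo x y u xs ys us (n + 1) - distTo x y u xs ys us n| ≤ stepLen x y u (n + 1) := by
  have key : ∀ {V : Type} [NormedAddCommGroup V] (a b v : V),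
      |‖a - v‖ - ‖b - v‖| ≤ ‖a - b‖ := fun a b v => by
    simpa using abs_norm_sub_norm_le (a - v) (b - v)
  have h1 := abs_le.1 (key (x (n + 2)) (x (n + 1)) xs)
  have h2 := abs_le.1 (key (y (n + 2)) (y (n + 1)) ys)
  have h3 := abs_le.1 (key (u (n + 2)) (u (n + 1)) us)
  change |(‖x (n + 2) - xs‖ + ‖y (n + 2) - ys‖ + ‖u (n + 2) - us‖)
    - (‖x (n + 1) - xs‖ + ‖y (n + 1) - ys‖ + ‖u (n + 1) - us‖)|
    ≤ ‖x (n + 2) - x (n + 1)‖ + ‖y (n + 2) - y (n + 1)‖ + ‖u (n + 2) - u (n + 1)‖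
  rw [abs_le]
  constructor <;> linarith [h1.1, h1.2, h2.1, h2.2, h3.1, h3.2]

theorem norm_z_sub_le (hgen : P.IsGenerated c x y z u) (hass : P.Assumptions c x y z u) (n : ℕ) :
    ‖z (n + 1) - P.A xs‖ ≤ (‖P.A‖ + (c.σ * c.β)⁻¹)
      * (distTo x y u xs ys us n + stepLen x y u n) := by
  have hpos : 0 < (c.σ * c.β)⁻¹ := inv_pos.2 (mul_pos hass.σ_pos hass.β_pos)
  have h1 : z (n + 1) - P.A xs = P.A (x (n + 1) - xs) - (c.σ * c.β)⁻¹ • (u (n + 1) - u n) := by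
    rw [← residual_eq hgen hass, map_sub]; abel
  have hs := stepLen_nonneg (x := x) (y := y) (u := u) n
  have hd := distTo_nonneg (x := x) (y := y) (u := u) (xs := xs) (ys := ys) (us := us) n
  have h2 : ‖x (n + 1) - xs‖ ≤ distTo x y u xs ys us n + stepLen x y u n := by
    rw [distTo]
    linarith [norm_nonneg (y (n + 1) - ys), norm_nonneg (u (n + 1) - us)]
  have h3 : ‖u (n + 1) - u n‖ ≤ distTo x y u xs ys us n + stepLen x y u n := by
    rw [stepLen]
    linarith [norm_nonneg (x (n + 1) - x n), norm_nonneg (y (n + 1) - y n)]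
  rw [h1, add_mul]
  refine (norm_sub_le _ _).trans (add_le_add ?_ ?_)
  · exact (P.A.le_opNorm _).trans (by gcongr)
  · rw [norm_smul, Real.norm_of_nonneg hpos.le]
    gcongr

theorem dist_iter_le (hgen : P.IsGenerated c x y z u) (hass : P.Assumptions c x y z u) (n : ℕ) :
    ‖iter x y z u n - mkR xs ys (P.A xs) us xs us‖ ≤ (‖P.A‖ + (c.σ * c.β)⁻¹ + 2)
      * (distTo x y u xs ys us n + stepLen x y u n) := by
  have h0 : iter x y z u n - mkR xs ys (P.A xs) us xs us
      = mkR (x (n + 1) - xs) (y (n + 1) - ys) (z (n + 1) - P.A xs) (u (n + 1) - us) (x n - xs)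
        (u n - us) := rfl
  have hz := norm_z_sub_le (xs := xs) (ys := ys) (us := us) hgen hass n
  have h1 : ‖x n - xs‖ ≤ ‖x (n + 1) - xs‖ + ‖x (n + 1) - x n‖ := by
    have := norm_sub_le (x (n + 1) - xs) (x (n + 1) - x n)
    rwa [sub_sub_sub_cancel_left] at this
  have h2 : ‖u n - us‖ ≤ ‖u (n + 1) - us‖ + ‖u (n + 1) - u n‖ := by
    have := norm_sub_le (u (n + 1) - us) (u (n + 1) - u n)
    rwa [sub_sub_sub_cancel_left] at this
  rw [h0, add_mul]
  refine (norm_mkR_le _ _ _ _ _ _).trans ?_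
  have h3 : ‖x (n + 1) - xs‖ + ‖y (n + 1) - ys‖ + ‖u (n + 1) - us‖ + ‖x n - xs‖ + ‖u n - us‖
      ≤ 2 * (distTo x y u xs ys us n + stepLen x y u n) := by
    rw [distTo, stepLen]
    linarith [norm_nonneg (y (n + 1) - ys), norm_nonneg (y (n + 1) - y n),
      norm_nonneg (x (n + 1) - x n), norm_nonneg (u (n + 1) - u n)]
  linarith

/-- The Łojasiewicz inequality along the iterates, in terms of the step length. -/
theorem loja_iter (hP : P.WellPosed) (hgen : P.IsGenerated c x y z u)
    (hass : P.Assumptions c x y z u) {l C θ : ℝ} (hC : 0 < C) (hθ : 0 ≤ θ)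
    (hl : ∀ n, l ≤ psiSeq P c x y z u n)
    (hval : P.Psi c (mkR xs ys (P.A xs) us xs us) = l)
    (hL : LojasiewiczAt (P.Psi c) (mkR xs ys (P.A xs) us xs us) C θ) :
    ∃ C' > 0, ∃ ε > 0, ∀ n, distTo x y u xs ys us n + stepLen x y u n < ε →
      psiSeq P c x y z u n - l ≠ 0 →
      (psiSeq P c x y z u n - l) ^ θ ≤ C' * stepLen x y u n := by
  obtain ⟨ε, hε, hL⟩ := hL
  obtain ⟨K, hK, hD⟩ := (isBigO_subgradPsi hgen hass).exists_pos
  rw [isBigOWith_top] at hD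
  have hinv : 0 < (c.σ * c.β)⁻¹ := inv_pos.2 (mul_pos hass.σ_pos hass.β_pos)
  have hk : 0 < ‖P.A‖ + (c.σ * c.β)⁻¹ + 2 := by positivity
  -- `K` bounds the subgradient by the step length; dividing `ε` by the constant of `dist_iter_le`
  -- keeps `iter x y z u n` inside the Łojasiewicz ball.
  refine ⟨C * K, by positivity, ε / (‖P.A‖ + (c.σ * c.β)⁻¹ + 2), by positivity,
    fun n hn hne => ?_⟩
  have hball : iter x y z u n ∈ Metric.ball (mkR xs ys (P.A xs) us xs us) ε := by
    rw [mem_ball_iff_norm]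
    refine (dist_iter_le hgen hass n).trans_lt ?_
    rwa [lt_div_iff₀ hk, mul_comm] at hn
  have hs := stepLen_nonneg (x := x) (y := y) (u := u) n
  have hnn : 0 ≤ psiSeq P c x y z u n - l := sub_nonneg.2 (hl n)
  have h := hL _ hball (by
    rw [hval, Psi_iter hP hgen]
    exact fun h => hne (sub_eq_zero.2 (EReal.coe_injective h)))
  rw [hval, Psi_iter hP hgen, ← EReal.coe_sub, EReal.abs_def, abs_of_nonneg hnn,
    ENNReal.ofReal_rpow_of_nonneg hnn hθ] at h
  have h1 : Metric.infEDist 0 (limitingSubdiff (P.Psi c) (iter x y z u n))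
      ≤ ENNReal.ofReal (K * stepLen x y u n) := by
    refine (Metric.infEDist_le_edist_of_mem
      (mem_limitingSubdiff_of_mem_frechetSubdiff (subgradPsi_mem hP hgen n))).trans ?_
    rw [edist_dist, dist_zero_left]
    refine ENNReal.ofReal_le_ofReal ((hD n).trans_eq ?_)
    rw [Real.norm_of_nonneg hs]
  have h2 := h.trans (mul_le_mul_right h1 _)
  rw [← ENNReal.ofReal_mul hC.le, ENNReal.ofReal_le_ofReal_iff (by positivity)] at h2
  linarith

theorem tendsto_of_distTo (h : Tendsto (distTo x y u xs ys us) atTop (𝓝 0)) :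
    Tendsto x atTop (𝓝 xs) ∧ Tendsto y atTop (𝓝 ys) ∧ Tendsto u atTop (𝓝 us) := by
  refine ⟨?_, ?_, ?_⟩ <;> rw [← tendsto_add_atTop_iff_nat 1, tendsto_iff_norm_sub_tendsto_zero] <;>
    refine squeeze_zero (fun _ => norm_nonneg _) (fun n => ?_) h <;> rw [distTo] <;>
    linarith [norm_nonneg (x (n + 1) - xs), norm_nonneg (y (n + 1) - ys),
      norm_nonneg (u (n + 1) - us)]

theorem frequently_distTo_lt {φ : ℕ → ℕ} (hφ : Tendsto φ atTop atTop)
    (hx : Tendsto (fun k => x (φ k)) atTop (𝓝 xs)) (hy : Tendsto (fun k => y (φ k)) atTop (𝓝 ys))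
    (hu : Tendsto (fun k => u (φ k)) atTop (𝓝 us)) {δ : ℝ} (hδ : 0 < δ) (N : ℕ) :
    ∃ n ≥ N, distTo x y u xs ys us n < δ := by
  rw [tendsto_iff_norm_sub_tendsto_zero] at hx hy hu
  have h := (hx.add hy).add hu
  simp only [add_zero] at h
  -- `distTo` at index `j` measures iterate `j + 1`, so `φ k ≥ N + 1` is needed to step back by one.
  obtain ⟨k, hk1, hk2⟩ := ((h.eventually_lt_const hδ).and
    (hφ.eventually_ge_atTop (N + 1))).exists
  obtain ⟨j, hj⟩ : ∃ j, φ k = j + 1 := ⟨φ k - 1, by omega⟩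
  rw [hj] at hk1 hk2
  exact ⟨j, by omega, hk1⟩

end Convergence

end SplittingKL

end

/-! ### Convergence and rates -/

theorem mainTheorem3 {m q p : ℕ} (hp : 0 < p)
    (P : SplittingKL.Problem m q p) (c : SplittingKL.Params) (hP : P.WellPosed)
    (x : ℕ → SplittingKL.E m) (y : ℕ → SplittingKL.E q)
    (z : ℕ → SplittingKL.E p) (u : ℕ → SplittingKL.E p)
    (hgen : P.IsGenerated c x y z u)
    (hass : P.Assumptions c x y z u)
    (hLoj : SplittingKL.LojasiewiczProperty (P.Psi c)) :
    ∃ (xs : SplittingKL.E m) (ys : SplittingKL.E q)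
      (zs : SplittingKL.E p) (us : SplittingKL.E p),
      P.IsKKT xs ys zs us ∧
      Tendsto x atTop (𝓝 xs) ∧ Tendsto y atTop (𝓝 ys) ∧
      Tendsto z atTop (𝓝 zs) ∧ Tendsto u atTop (𝓝 us) ∧
      SplittingKL.mkR xs ys zs us xs us ∈ SplittingKL.crit (P.Psi c) ∧
      ∀ C_L θ : ℝ, 0 < C_L → 0 ≤ θ → θ < 1 →
        SplittingKL.LojasiewiczAt (P.Psi c) (SplittingKL.mkR xs ys zs us xs us) C_L θ →
        (θ = 0 → ∃ n₀ : ℕ, ∀ n ≥ n₀, x n = xs ∧ y n = ys ∧ z n = zs ∧ u n = us) ∧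
        (0 < θ → θ ≤ 1 / 2 →
          ∃ n₀ : ℕ, 1 ≤ n₀ ∧ ∃ K₁ K₂ K₃ K₄ Q : ℝ,
            0 < K₁ ∧ 0 < K₂ ∧ 0 < K₃ ∧ 0 < K₄ ∧ 0 ≤ Q ∧ Q < 1 ∧
            ∀ n ≥ n₀,
              ‖x n - xs‖ ≤ K₁ * Q ^ n ∧ ‖y n - ys‖ ≤ K₂ * Q ^ n ∧
              ‖z n - zs‖ ≤ K₃ * Q ^ n ∧ ‖u n - us‖ ≤ K₄ * Q ^ n) ∧
        (1 / 2 < θ →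
          ∃ n₀ : ℕ, 1 ≤ n₀ ∧ ∃ K₁ K₂ K₃ K₄ : ℝ,
            0 < K₁ ∧ 0 < K₂ ∧ 0 < K₃ ∧ 0 < K₄ ∧
            ∀ n ≥ n₀ + 1,
              ‖x n - xs‖ ≤ K₁ * (n : ℝ) ^ (-((1 - θ) / (2 * θ - 1))) ∧
              ‖y n - ys‖ ≤ K₂ * (n : ℝ) ^ (-((1 - θ) / (2 * θ - 1))) ∧
              ‖z n - zs‖ ≤ K₃ * (n : ℝ) ^ (-((1 - θ) / (2 * θ - 1))) ∧
              ‖u n - us‖ ≤ K₄ * (n : ℝ) ^ (-((1 - θ) / (2 * θ - 1)))) := by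
  obtain ⟨φ, xs, ys, us, hφ, hxφ, hyφ, huφ⟩ := SplittingKL.exists_cluster_point hass
  obtain ⟨l, hl, hle⟩ := SplittingKL.exists_tendsto_psiSeq hp hP hgen hass
  obtain ⟨a, ha, hdesc⟩ := SplittingKL.exists_descent hp hP hgen hass
  obtain ⟨hKKT, hval, hcrit⟩ := SplittingKL.cluster_point hp hP hgen hass hφ hxφ hyφ huφ hl
  set e : ℕ → ℝ := fun n => SplittingKL.psiSeq P c x y z u n - l with hedef
  have he : ∀ n, 0 ≤ e n := fun n => sub_nonneg.2 (hle n)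
  have hedesc : ∀ n, e (n + 1) + a * SplittingKL.stepLen x y u (n + 1) ^ 2 ≤ e n := fun n => by
    simp only [hedef]
    linarith [hdesc n]
  have helim : Tendsto e atTop (𝓝 0) := by simpa [hedef] using hl.sub_const l
  have htrap : ∀ C θ : ℝ, 0 < C → 0 ≤ θ → θ < 1 →
      SplittingKL.LojasiewiczAt (P.Psi c) (SplittingKL.mkR xs ys (P.A xs) us xs us) C θ →
      ∃ C' > 0, Tendsto (SplittingKL.distTo x y u xs ys us) atTop (𝓝 0) ∧ ∃ N, ∀ n ≥ N,
        (e n ≠ 0 → e n ^ θ ≤ C' * SplittingKL.stepLen x y u n) ∧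
        SplittingKL.distTo x y u xs ys us n
          ≤ SplittingKL.stepLen x y u n + C' / (a * (1 - θ)) * e n ^ (1 - θ) := by
    intro C θ hC h0 h1 hL
    obtain ⟨C', hC', ε, hε, hL'⟩ := SplittingKL.loja_iter hP hgen hass hC h0 hle hval hL
    exact ⟨C', hC', SplittingKL.loja_trap ha hC' h0 h1 hε he
      (fun n => SplittingKL.stepLen_nonneg n) (fun n => SplittingKL.distTo_nonneg n) hedesc helim
      (fun n => SplittingKL.abs_distTo_sub_le n)
      (fun δ hδ N => SplittingKL.frequently_distTo_lt hφ hxφ hyφ huφ hδ N) hL'⟩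
  -- The assumed property supplies some exponent at the cluster point, which is enough for
  -- convergence. The trapping is repeated below with the given `C_L` and `θ` to obtain the rates at
  -- the same limit.
  obtain ⟨C, θ, hC, h0, h1, hL⟩ := hLoj _ hcrit
  obtain ⟨-, -, hd, -⟩ := htrap C θ hC h0 h1 hL
  obtain ⟨hx, hy, hu⟩ := SplittingKL.tendsto_of_distTo hd
  set D : ℕ → ℝ := fun n =>
    SplittingKL.distTo x y u xs ys us n + SplittingKL.stepLen x y u n with hD
  have hs := SplittingKL.tendsto_stepLen hp hP hgen hass
  set Kz : ℝ := ‖P.A‖ + (c.σ * c.β)⁻¹ with hKzdef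
  have hKz : 0 < Kz := add_pos_of_nonneg_of_pos (norm_nonneg _)
    (inv_pos.2 (mul_pos hass.σ_pos hass.β_pos))
  have hzD : ∀ n, ‖z (n + 1) - P.A xs‖ ≤ Kz * D n := fun n =>
    SplittingKL.norm_z_sub_le hgen hass n
  have hxyu : ∀ n, ‖x (n + 1) - xs‖ ≤ D n ∧ ‖y (n + 1) - ys‖ ≤ D n ∧ ‖u (n + 1) - us‖ ≤ D n := by
    intro n
    have := SplittingKL.stepLen_nonneg (x := x) (y := y) (u := u) n
    simp only [hD, SplittingKL.distTo]
    refine ⟨?_, ?_, ?_⟩ <;> linarith [norm_nonneg (x (n + 1) - xs), norm_nonneg (y (n + 1) - ys),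
      norm_nonneg (u (n + 1) - us)]
  have hz : Tendsto z atTop (𝓝 (P.A xs)) := by
    rw [← tendsto_add_atTop_iff_nat 1, tendsto_iff_norm_sub_tendsto_zero]
    refine squeeze_zero (fun _ => norm_nonneg _) hzD ?_
    simpa using (hd.add hs).const_mul Kz
  have hpred : ∀ {n N : ℕ}, N + 1 ≤ n → ∃ k ≥ N, n = k + 1 := fun {n N} h =>
    ⟨n - 1, by omega, by omega⟩
  refine ⟨xs, ys, P.A xs, us, hKKT, hx, hy, hz, hu, hcrit, ?_⟩
  intro C θ hC h0 h1 hL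
  obtain ⟨C', hC', -, N, hN⟩ := htrap C θ hC h0 h1 hL
  have hK : 0 ≤ C' / (a * (1 - θ)) :=
    div_nonneg hC'.le (mul_nonneg ha.le (sub_nonneg.2 h1.le))
  refine ⟨fun hθ => ?_, fun _ hθ => ?_, fun hθ => ?_⟩
  · subst hθ
    obtain ⟨N', hN'⟩ := SplittingKL.finite_convergence ha hC' he
      (fun n => SplittingKL.distTo_nonneg n) hedesc helim hN
    refine ⟨N' + 1, fun n hn => ?_⟩
    obtain ⟨k, hk, rfl⟩ := hpred hn
    have hDk : D k = 0 := hN' k hk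
    obtain ⟨e1, e2, e3⟩ := hxyu k
    have e4 := hzD k
    rw [hDk] at e1 e2 e3 e4
    rw [mul_zero] at e4
    exact ⟨sub_eq_zero.1 (norm_le_zero_iff.1 e1), sub_eq_zero.1 (norm_le_zero_iff.1 e2),
      sub_eq_zero.1 (norm_le_zero_iff.1 e4), sub_eq_zero.1 (norm_le_zero_iff.1 e3)⟩
  · obtain ⟨N', M, Q, hM, hQ0, hQ1, hN'⟩ :=
      SplittingKL.linear_convergence ha hC' hK hθ he hedesc helim hN
    refine ⟨N' + 1, Nat.succ_pos _, M, M, Kz * M, M, Q, hM, hM, mul_pos hKz hM, hM, hQ0.le, hQ1,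
      fun n hn => ?_⟩
    obtain ⟨k, hk, rfl⟩ := hpred hn
    have hDk : D k ≤ M * Q ^ (k + 1) := hN' k hk
    obtain ⟨e1, e2, e3⟩ := hxyu k
    refine ⟨e1.trans hDk, e2.trans hDk, (hzD k).trans ?_, e3.trans hDk⟩
    rw [mul_assoc]
    exact mul_le_mul_of_nonneg_left hDk hKz.le
  · obtain ⟨N', M, hM, hN'⟩ :=
      SplittingKL.sublinear_convergence ha hC' hK hθ h1 he hedesc helim hN
    refine ⟨N' + 1, Nat.succ_pos _, M, M, Kz * M, M, hM, hM, mul_pos hKz hM, hM, fun n hn => ?_⟩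
    obtain ⟨k, hk, rfl⟩ := hpred ((Nat.le_succ _).trans hn)
    have hDk : D k ≤ M * (((k + 1 : ℕ) : ℝ)) ^ (-((1 - θ) / (2 * θ - 1))) := by
      push_cast
      exact hN' k hk
    obtain ⟨e1, e2, e3⟩ := hxyu k
    refine ⟨e1.trans hDk, e2.trans hDk, (hzD k).trans ?_, e3.trans hDk⟩
    rw [mul_assoc]
    exact mul_le_mul_of_nonneg_left hDk hKz.le
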